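/- Let $\mathcal C$ be a braided monoidal category with braiding $\Phi$, and let $H$ be a Hopf algebra in $\mathcal C$ with bijective antipode. Let $\mathcal C_H$ be the monoidal category of right $H$-modules in $\mathcal C$ (diagonal action on tensor products), and assume that $\Phi_{H,M}$ is symmetric, i.e. $\Phi_{M,H}\Phi_{H,M}=\mathrm{id}$, for all $M\in\mathcal C_H$. Let $H$ be quasitriangular: there is a morphism $\mathcal R=R^1\otimes R^2: I\to H\otimes H$, invertible in the algebra $H\otimes H$, such that $(\Delta\otimes \mathrm{id})\mathcal R=\mathcal R_{13}\mathcal R_{23}$, $(\mathrm{id}\otimes\Delta)\mathcal R=\mathcal R_{13}\mathcal R_{12}$ and $\Delta^{op}(h)\,\mathcal R=\mathcal R\,\Delta(h)$, where $\Delta^{op}=\Phi_{H,H}\Delta$. Then $\mathcal C_H$ is braided by $x\otimes y\mapsto yR^1\otimes xR^2$. Let $B$ be a Hopf algebra in the braided category $\mathcal C_H$. (Element formulas stand for the corresponding morphisms of $\mathcal C$, strands being interchanged by $\Phi$.) Let $\mathcal{YD}(\mathcal C)_H^H$ be the braided category of right-right Yetter--Drinfel'd modules over $H$ in $\mathcal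 C$ with braiding $\Phi^R_{X,Y}: x\otimes y\mapsto y_{(0)}\otimes x\,y_{(1)}$. (1) Equipped with the right coaction $\rho_B: b\mapsto bR^1\otimes R^2$, and with the same structure morphisms, $B$ is a Hopf algebra in $\mathcal{YD}(\mathcal C)_H^H$. (2) The bosonization $H\ltimes B$, i.e. the object $H\otimes B$ of $\mathcal C$ with multiplication $(h\otimes b)(h'\otimes b')=hh'_{(1)}\otimes (b\,h'_{(2)})\,b'$, unit $\eta_H\otimes\eta_B$, comultiplication $h\otimes b\mapsto \big(h_{(1)}\otimes b_{(1)(0)}\big)\otimes\big(h_{(2)}b_{(1)(1)}\otimes b_{(2)}\big)$, counit $\varepsilon_H\otimes\varepsilon_B$ and antipode $\Phi^R_{B,H}\,(S_B\otimes S_H)\,\Phi^R_{H,B}$, is a Hopf algebra in $\mathcal C$. Here $\Phi^R_{H,B}(h\otimes b)=b_{(0)}\otimes h\,b_{(1)}$ and $\Phi^R_{B,H}(b\otimes h)=h_{(1)}\otimes b\,h_{(2)}$. (3) There is a monoidal isomorphism of categories $\mathcal F:(\mathcal C_H)_B\to\mathcal C_{H\ltimes B}$ from the category of right $B$-modules in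 $\mathcal C_H$ to the category of right $H\ltimes B$-modules in $\mathcal C$. It is the identity on underlying objects and morphisms of $\mathcal C$, its monoidal structure morphisms are identities on underlying objects, and $\mathcal F(M)$ carries the action $m\cdot(h\otimes b)=(m\,h)\,b$. -/

import Mathlib

open CategoryTheory MonoidalCategory
open scoped MonObj ComonObj HopfObj

universe v u

namespace BraidedHopf

section Actions

variable {C : Type u} [Category.{v} C] [MonoidalCategory C]

/-- `a : X ⊗ A ⟶ X` is a (unital, associative) right action of the algebra `A` on `X`. -/
structure IsAction {A : C} [MonObj A] {X : C} (a : X ⊗ A ⟶ X) : Prop where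
  one : X ◁ η[A] ≫ a = (ρ_ X).hom
  mul : X ◁ μ[A] ≫ a = (α_ X A A).inv ≫ a ▷ A ≫ a

/-- An action can be restricted along a morphism of algebras. -/
theorem IsAction.restrict {A A' X : C} [MonObj A] [MonObj A'] {a : X ⊗ A' ⟶ X}
    (ha : IsAction a) {f : A ⟶ A'} (h1 : η[A] ≫ f = η[A'])
    (hf : μ[A] ≫ f = (f ⊗ₘ f) ≫ μ[A']) : IsAction (X ◁ f ≫ a) where
  one := by rw [← whiskerLeft_comp_assoc, h1, ha.one]
  mul := by
    rw [← whiskerLeft_comp_assoc, hf, whiskerLeft_comp_assoc, ha.mul,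
      MonoidalCategory.tensorHom_def']
    simp only [comp_whiskerRight, Category.assoc, ← whisker_exchange_assoc]
    monoidal

theorem isAction_unit : IsAction (A := 𝟙_ C) (λ_ (𝟙_ C)).hom where
  one := by simp; monoidal
  mul := by simp; monoidal

theorem isAction_mul {A : C} [MonObj A] : IsAction μ[A] where
  one := by simp
  mul := by simp

variable [BraidedCategory C]

/-- The action of `A ⊗ A'` on the tensor product of an `A`-module and an `A'`-module. -/
def extAct {A A' X Y : C} (a : X ⊗ A ⟶ X) (b : Y ⊗ A' ⟶ Y) :
    (X ⊗ Y) ⊗ (A ⊗ A') ⟶ X ⊗ Y :=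
  tensorμ X Y A A' ≫ (a ⊗ₘ b)

theorem IsAction.ext {A A' X Y : C} [MonObj A] [MonObj A'] {a : X ⊗ A ⟶ X} {b : Y ⊗ A' ⟶ Y}
    (ha : IsAction a) (hb : IsAction b) : IsAction (extAct a b) where
  one := by
    simp only [extAct, MonObj.tensorObj.one_def, whiskerLeft_comp, Category.assoc]
    rw [tensorμ_natural_right_assoc, tensorHom_comp_tensorHom, ha.one, hb.one,
      ← tensor_right_unitality]
  mul := by
    rw [Iso.eq_inv_comp]
    simp only [extAct, MonObj.tensorObj.mul_def, whiskerLeft_comp, comp_whiskerRight,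
      Category.assoc]
    rw [tensorμ_natural_right_assoc, tensorHom_comp_tensorHom, ha.mul, hb.mul,
      tensorμ_natural_left_assoc, tensorHom_comp_tensorHom, ← tensorHom_comp_tensorHom,
      ← Category.assoc (tensorμ _ _ _ _ ▷ _), ← reassoc_of% tensor_associativity,
      tensorHom_comp_tensorHom_assoc]
    simp

theorem extAct_natural {A A' X Y X' Y' : C} {a : X ⊗ A ⟶ X} {b : Y ⊗ A' ⟶ Y}
    {a' : X' ⊗ A ⟶ X'} {b' : Y' ⊗ A' ⟶ Y'} {f : X ⟶ X'} {g : Y ⟶ Y'}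
    (hf : a ≫ f = f ▷ A ≫ a') (hg : b ≫ g = g ▷ A' ≫ b') :
    extAct a b ≫ (f ⊗ₘ g) = (f ⊗ₘ g) ▷ (A ⊗ A') ≫ extAct a' b' := by
  simp only [extAct, Category.assoc, tensorHom_comp_tensorHom, hf, hg]
  rw [← tensorHom_comp_tensorHom, ← tensorμ_natural_left_assoc]

variable {H : C} [BimonObj H]

/-- The diagonal action of a bialgebra on a tensor product of right modules,
`(X ⊗ Y) ⊗ H ⟶ (X ⊗ Y) ⊗ (H ⊗ H) ⟶ (X ⊗ H) ⊗ (Y ⊗ H) ⟶ X ⊗ Y`. -/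
def diagAct {X Y : C} (a : X ⊗ H ⟶ X) (b : Y ⊗ H ⟶ Y) : (X ⊗ Y) ⊗ H ⟶ X ⊗ Y :=
  (X ⊗ Y) ◁ Δ[H] ≫ tensorμ X Y H H ≫ (a ⊗ₘ b)

theorem IsAction.diag {X Y : C} {a : X ⊗ H ⟶ X} {b : Y ⊗ H ⟶ Y} (ha : IsAction a)
    (hb : IsAction b) : IsAction (diagAct a b) :=
  (ha.ext hb).restrict (BimonObj.one_comul H)
    (by rw [BimonObj.mul_comul, MonObj.tensorObj.mul_def])

theorem diagAct_natural {X Y X' Y' : C} {a : X ⊗ H ⟶ X} {b : Y ⊗ H ⟶ Y}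
    {a' : X' ⊗ H ⟶ X'} {b' : Y' ⊗ H ⟶ Y'} {f : X ⟶ X'} {g : Y ⟶ Y'}
    (hf : a ≫ f = f ▷ H ≫ a') (hg : b ≫ g = g ▷ H ≫ b') :
    diagAct a b ≫ (f ⊗ₘ g) = (f ⊗ₘ g) ▷ H ≫ diagAct a' b' := by
  have := extAct_natural hf hg
  simp only [extAct, Category.assoc] at this
  simp only [diagAct, Category.assoc, this, whisker_exchange_assoc]

variable (H) in
/-- The trivial action on the unit object, given by the counit. -/
def unitAct : 𝟙_ C ⊗ H ⟶ 𝟙_ C := (λ_ H).hom ≫ ε[H]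

theorem isAction_unitAct : IsAction (unitAct H) := by
  have h := (isAction_unit (C := C)).restrict (BimonObj.one_counit H)
    (by rw [BimonObj.mul_counit]; rfl)
  rwa [leftUnitor_naturality] at h

theorem diagAct_associator {X Y Z : C} (a : X ⊗ H ⟶ X) (b : Y ⊗ H ⟶ Y) (c : Z ⊗ H ⟶ Z) :
    diagAct (diagAct a b) c ≫ (α_ X Y Z).hom =
      (α_ X Y Z).hom ▷ H ≫ diagAct a (diagAct b c) := by
  simp only [diagAct]
  have h1 : ((X ⊗ Y) ◁ Δ[H] ≫ tensorμ X Y H H ≫ (a ⊗ₘ b)) ⊗ₘ c =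
      ((X ⊗ Y) ◁ Δ[H] ⊗ₘ Z ◁ 𝟙 H) ≫ (tensorμ X Y H H ▷ _) ≫ ((a ⊗ₘ b) ⊗ₘ c) := by
    rw [← tensorHom_id, tensorHom_comp_tensorHom, tensorHom_comp_tensorHom]; simp
  have h2 : (a ⊗ₘ ((Y ⊗ Z) ◁ Δ[H] ≫ tensorμ Y Z H H ≫ (b ⊗ₘ c))) =
      (X ◁ 𝟙 H ⊗ₘ (Y ⊗ Z) ◁ Δ[H]) ≫ (_ ◁ tensorμ Y Z H H) ≫ (a ⊗ₘ (b ⊗ₘ c)) := by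
    rw [← id_tensorHom (X ⊗ H), tensorHom_comp_tensorHom, tensorHom_comp_tensorHom]; simp
  rw [h1, h2, ← tensorμ_natural_right_assoc, ← tensorμ_natural_right_assoc, Category.assoc,
    Category.assoc, Category.assoc, Category.assoc, associator_naturality,
    associator_monoidal_assoc]
  simp only [id_tensorHom, tensorHom_id, ← whiskerLeft_comp_assoc]
  rw [ComonObj.comul_assoc_flip, ← whisker_exchange_assoc, MonoidalCategory.tensorHom_def']
  simp only [Category.assoc, whiskerLeft_comp]
  simp

theorem diagAct_leftUnitor {X : C} (a : X ⊗ H ⟶ X) :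
    diagAct (unitAct H) a ≫ (λ_ X).hom = (λ_ X).hom ▷ H ≫ a := by
  simp only [diagAct, unitAct]
  have h1 : ((λ_ H).hom ≫ ε[H]) ⊗ₘ a =
    (𝟙_ C ◁ ε[H] ⊗ₘ X ◁ 𝟙 H) ≫ ((λ_ (𝟙_ C)).hom ▷ _) ≫ _ ◁ a := by
    simp [MonoidalCategory.tensorHom_def]
  rw [h1, ← tensorμ_natural_right_assoc, tensorHom_id, ← whiskerLeft_comp_assoc,
    ComonObj.counit_comul, Category.assoc, Category.assoc, Category.assoc,
    leftUnitor_naturality, ← leftUnitor_monoidal_assoc]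
  simp [MonoidalCategory.tensorHom_def]

theorem diagAct_rightUnitor {X : C} (a : X ⊗ H ⟶ X) :
    diagAct a (unitAct H) ≫ (ρ_ X).hom = (ρ_ X).hom ▷ H ≫ a := by
  simp only [diagAct, unitAct]
  have h1 : a ⊗ₘ ((λ_ H).hom ≫ ε[H]) =
    (X ◁ 𝟙 H ⊗ₘ 𝟙_ C ◁ ε[H]) ≫ (_ ◁ (λ_ (𝟙_ C)).hom) ≫ a ▷ _ := by
    simp [MonoidalCategory.tensorHom_def']
  rw [h1, ← tensorμ_natural_right_assoc, id_tensorHom, ← whiskerLeft_comp_assoc,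
    ComonObj.comul_counit, Category.assoc, Category.assoc, Category.assoc,
    rightUnitor_naturality, ← rightUnitor_monoidal_assoc]
  simp [MonoidalCategory.tensorHom_def]

end Actions

section Modules

variable {C : Type u} [Category.{v} C] [MonoidalCategory C]

/-- A right module over the algebra `A`. -/
structure RMod (A : C) [MonObj A] where
  /-- the underlying object -/
  X : C
  /-- the right action -/
  act : X ⊗ A ⟶ X
  isAction : IsAction act

namespace RMod

section Category

variable {A : C} [MonObj A]

/-- A morphism of right modules: an `A`-linear morphism of `C`. -/
@[ext]
structure Hom (M N : RMod A) where
  /-- the underlying morphism -/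
  hom : M.X ⟶ N.X
  linear : M.act ≫ hom = hom ▷ A ≫ N.act

instance : Category (RMod A) where
  Hom M N := Hom M N
  id M := ⟨𝟙 M.X, by simp⟩
  comp f g := ⟨f.hom ≫ g.hom, by
    rw [← Category.assoc, f.linear, Category.assoc, g.linear, comp_whiskerRight, Category.assoc]⟩

@[ext]
theorem hom_ext {M N : RMod A} {f g : M ⟶ N} (h : f.hom = g.hom) : f = g := Hom.ext h

@[simp] theorem id_hom (M : RMod A) : Hom.hom (𝟙 M) = 𝟙 M.X := rfl

@[simp] theorem comp_hom {M N P : RMod A} (f : M ⟶ N) (g : N ⟶ P) :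
    (f ≫ g).hom = f.hom ≫ g.hom := rfl

/-- An isomorphism of `C` which is linear is an isomorphism of modules. -/
@[simps] def mkIso {M N : RMod A} (e : M.X ≅ N.X) (h : M.act ≫ e.hom = e.hom ▷ A ≫ N.act) :
    M ≅ N where
  hom := ⟨e.hom, h⟩
  inv := ⟨e.inv, by
    rw [Iso.comp_inv_eq, Category.assoc, h, ← comp_whiskerRight_assoc, e.inv_hom_id,
      id_whiskerRight, Category.id_comp]⟩
  hom_inv_id := by ext; simp
  inv_hom_id := by ext; simp

variable (A) in
/-- The forgetful functor. -/
@[simps] def forget : RMod A ⥤ C where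
  obj M := M.X
  map f := f.hom

end Category

variable [BraidedCategory C] {H : C} [BimonObj H]

/-- Right modules over a bialgebra `H` form a monoidal category, with the diagonal action on
tensor products, the trivial action on the unit, and the constraints of `C`. -/
instance : MonoidalCategory (RMod H) where
  tensorObj M N := ⟨M.X ⊗ N.X, diagAct M.act N.act, M.isAction.diag N.isAction⟩
  tensorUnit := ⟨𝟙_ C, unitAct H, isAction_unitAct⟩
  tensorHom f g := ⟨f.hom ⊗ₘ g.hom, diagAct_natural f.linear g.linear⟩
  whiskerLeft M _ _ f := ⟨M.X ◁ f.hom, by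
    rw [← id_tensorHom]; exact diagAct_natural (Hom.linear (𝟙 M)) f.linear⟩
  whiskerRight f M := ⟨f.hom ▷ M.X, by
    rw [← tensorHom_id]; exact diagAct_natural f.linear (Hom.linear (𝟙 M))⟩
  associator M N P := mkIso (α_ M.X N.X P.X) (diagAct_associator M.act N.act P.act)
  leftUnitor M := mkIso (λ_ M.X) (diagAct_leftUnitor M.act)
  rightUnitor M := mkIso (ρ_ M.X) (diagAct_rightUnitor M.act)
  tensorHom_def f g := by ext; exact MonoidalCategory.tensorHom_def _ _
  id_tensorHom_id _ _ := by ext; exact id_tensorHom_id _ _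
  tensorHom_comp_tensorHom _ _ _ _ := by ext; exact tensorHom_comp_tensorHom _ _ _ _
  whiskerLeft_id _ _ := by ext; exact whiskerLeft_id _ _
  id_whiskerRight _ _ := by ext; exact id_whiskerRight _ _
  associator_naturality _ _ _ := by ext; exact associator_naturality _ _ _
  leftUnitor_naturality _ := by ext; exact leftUnitor_naturality _
  rightUnitor_naturality _ := by ext; exact rightUnitor_naturality _
  pentagon _ _ _ _ := by ext; exact pentagon _ _ _ _
  triangle _ _ := by ext; exact triangle _ _

/-- The forgetful functor is strict monoidal: its structure morphisms are identities. -/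
instance : (forget H).Monoidal :=
  Functor.CoreMonoidal.toMonoidal
    { εIso := Iso.refl (𝟙_ C)
      μIso := fun M N => Iso.refl (M.X ⊗ N.X)
      μIso_hom_natural_left := fun f M => by
        exact (Category.comp_id _).trans (Category.id_comp _).symm
      μIso_hom_natural_right := fun M f => by
        exact (Category.comp_id _).trans (Category.id_comp _).symm
      associativity := fun M N P => by
        change (𝟙 (M.X ⊗ N.X)) ▷ P.X ≫ 𝟙 _ ≫ (α_ M.X N.X P.X).hom =
          (α_ M.X N.X P.X).hom ≫ M.X ◁ 𝟙 (N.X ⊗ P.X) ≫ 𝟙 _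
        simp
      left_unitality := fun M => by
        change (λ_ M.X).hom = 𝟙 (𝟙_ C) ▷ M.X ≫ 𝟙 _ ≫ (λ_ M.X).hom
        simp
      right_unitality := fun M => by
        change (ρ_ M.X).hom = M.X ◁ 𝟙 (𝟙_ C) ≫ 𝟙 _ ≫ (ρ_ M.X).hom
        simp }

end RMod

end Modules

section Coactions
variable {C : Type u} [Category.{v} C] [MonoidalCategory C]

/-- `r : X ⟶ X ⊗ A` is a (counital, coassociative) right coaction of the coalgebra `A` on `X`. -/
structure IsCoaction {A : C} [ComonObj A] {X : C} (r : X ⟶ X ⊗ A) : Prop where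
  counit : r ≫ X ◁ ε[A] = (ρ_ X).inv
  comul : r ≫ X ◁ Δ[A] = r ≫ r ▷ A ≫ (α_ X A A).hom

variable [BraidedCategory C] {H : C}

/-- The codiagonal coaction of a bialgebra on a tensor product of right comodules,
`X ⊗ Y ⟶ (X ⊗ H) ⊗ (Y ⊗ H) ⟶ (X ⊗ Y) ⊗ (H ⊗ H) ⟶ (X ⊗ Y) ⊗ H`. -/
def diagCoact [MonObj H] {X Y : C} (r : X ⟶ X ⊗ H) (s : Y ⟶ Y ⊗ H) : X ⊗ Y ⟶ (X ⊗ Y) ⊗ H :=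
  (r ⊗ₘ s) ≫ tensorμ X H Y H ≫ (X ⊗ Y) ◁ μ[H]

/-- The morphism `x ⊗ y ↦ y₍₀₎ ⊗ x y₍₁₎` of `C`. -/
def ydBraid {X Y : C} (a : X ⊗ H ⟶ X) (s : Y ⟶ Y ⊗ H) : X ⊗ Y ⟶ Y ⊗ X :=
  X ◁ s ≫ (α_ X Y H).inv ≫ (β_ X Y).hom ▷ H ≫ (α_ Y X H).hom ≫ Y ◁ a

theorem ydBraid_hexagon_forward [BimonObj H] {X Y Z : C} {a : X ⊗ H ⟶ X} (ha : IsAction a)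
    (s : Y ⟶ Y ⊗ H) (t : Z ⟶ Z ⊗ H) :
    (α_ X Y Z).hom ≫ ydBraid a (diagCoact s t) ≫ (α_ Y Z X).hom =
      ydBraid a s ▷ Z ≫ (α_ Y X Z).hom ≫ Y ◁ ydBraid a t := by
  simp only [ydBraid, diagCoact, tensorμ, MonoidalCategory.tensorHom_def]
  symm
  calc
    _ = 𝟙 _ ⊗≫ X ◁ s ▷ Z ⊗≫ (β_ X Y).hom ▷ H ▷ Z ⊗≫ Y ◁ (a ▷ Z ≫ X ◁ t) ⊗≫
          Y ◁ (β_ X Z).hom ▷ H ⊗≫ Y ◁ Z ◁ a ⊗≫ 𝟙 _ := by monoidal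
    _ = 𝟙 _ ⊗≫ X ◁ s ▷ Z ⊗≫ (β_ X Y).hom ▷ H ▷ Z ⊗≫ Y ◁ X ◁ H ◁ t ⊗≫
          Y ◁ (a ▷ Z ≫ (β_ X Z).hom) ▷ H ⊗≫ Y ◁ Z ◁ a ⊗≫ 𝟙 _ := by
        rw [← whisker_exchange]; monoidal
    _ = 𝟙 _ ⊗≫ X ◁ s ▷ Z ⊗≫ ((β_ X Y).hom ▷ (H ⊗ Z) ≫ (Y ⊗ X) ◁ (H ◁ t ⊗≫
          (β_ H Z).hom ▷ H)) ⊗≫ Y ◁ (β_ X Z).hom ▷ H ▷ H ⊗≫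
          Y ◁ Z ◁ ((α_ X H H).inv ≫ a ▷ H ≫ a) ⊗≫ 𝟙 _ := by
        rw [BraidedCategory.braiding_naturality_left, BraidedCategory.braiding_tensor_left_hom]
        monoidal
    _ = 𝟙 _ ⊗≫ X ◁ s ▷ Z ⊗≫ X ◁ Y ◁ H ◁ t ⊗≫ X ◁ Y ◁ (β_ H Z).hom ▷ H ⊗≫
          (β_ X Y).hom ▷ Z ▷ H ▷ H ⊗≫ Y ◁ ((β_ X Z).hom ▷ (H ⊗ H) ≫ (Z ⊗ X) ◁ μ) ⊗≫
          Y ◁ Z ◁ a ⊗≫ 𝟙 _ := by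
        rw [← ha.mul, ← whisker_exchange]; monoidal
    _ = 𝟙 _ ⊗≫ X ◁ s ▷ Z ⊗≫ X ◁ Y ◁ H ◁ t ⊗≫ X ◁ Y ◁ (β_ H Z).hom ▷ H ⊗≫
          ((β_ X Y).hom ▷ (Z ⊗ H ⊗ H) ≫ (Y ⊗ X) ◁ Z ◁ μ) ⊗≫ Y ◁ (β_ X Z).hom ▷ H ⊗≫
          Y ◁ Z ◁ a ⊗≫ 𝟙 _ := by
        rw [← whisker_exchange]; monoidal
    _ = _ := by
        rw [← whisker_exchange, BraidedCategory.braiding_tensor_right_hom]; monoidal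

theorem ydBraid_hexagon_reverse [BimonObj H] {X Y Z : C} (a : X ⊗ H ⟶ X) (b : Y ⊗ H ⟶ Y)
    {t : Z ⟶ Z ⊗ H} (ht : IsCoaction t) :
    (α_ X Y Z).inv ≫ ydBraid (diagAct a b) t ≫ (α_ Z X Y).inv =
      X ◁ ydBraid b t ≫ (α_ X Z Y).inv ≫ ydBraid a t ▷ Y := by
  simp only [ydBraid, diagAct, tensorμ, MonoidalCategory.tensorHom_def]
  symm
  calc
    _ = 𝟙 _ ⊗≫ X ◁ Y ◁ t ⊗≫ X ◁ (β_ Y Z).hom ▷ H ⊗≫ X ◁ (Z ◁ b ≫ t ▷ Y) ⊗≫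
          (β_ X Z).hom ▷ H ▷ Y ⊗≫ Z ◁ a ▷ Y ⊗≫ 𝟙 _ := by monoidal
    _ = 𝟙 _ ⊗≫ X ◁ Y ◁ t ⊗≫ X ◁ ((β_ Y Z).hom ≫ t ▷ Y) ▷ H ⊗≫ X ◁ Z ◁ H ◁ b ⊗≫
          (β_ X Z).hom ▷ H ▷ Y ⊗≫ Z ◁ a ▷ Y ⊗≫ 𝟙 _ := by
        rw [whisker_exchange]; monoidal
    _ = 𝟙 _ ⊗≫ X ◁ Y ◁ (t ≫ t ▷ H ≫ (α_ Z H H).hom) ⊗≫ X ◁ (β_ Y Z).hom ▷ H ▷ H ⊗≫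
          X ◁ Z ◁ (β_ Y H).hom ▷ H ⊗≫ ((X ⊗ Z) ◁ H ◁ b ≫
          (β_ X Z).hom ▷ (H ⊗ Y)) ⊗≫ Z ◁ a ▷ Y ⊗≫ 𝟙 _ := by
        rw [← BraidedCategory.braiding_naturality_right,
          BraidedCategory.braiding_tensor_right_hom]; monoidal
    _ = 𝟙 _ ⊗≫ X ◁ Y ◁ t ⊗≫ X ◁ ((Y ⊗ Z) ◁ Δ ≫ (β_ Y Z).hom ▷ (H ⊗ H)) ⊗≫
          ((X ⊗ Z) ◁ (β_ Y H).hom ▷ H ≫ (β_ X Z).hom ▷ ((H ⊗ Y) ⊗ H)) ⊗≫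
           Z ◁ (X ⊗ H) ◁ b ⊗≫ Z ◁ a ▷ Y ⊗≫ 𝟙 _ := by
        rw [whisker_exchange, ← ht.comul]; monoidal
    _ = 𝟙 _ ⊗≫ X ◁ Y ◁ t ⊗≫ X ◁ (β_ Y Z).hom ▷ H ⊗≫
          ((X ⊗ Z) ◁ Y ◁ Δ ≫ (β_ X Z).hom ▷ (Y ⊗ H ⊗ H)) ⊗≫
           Z ◁ X ◁ (β_ Y H).hom ▷ H ⊗≫ Z ◁ ((X ⊗ H) ◁ b ≫ a ▷ Y) ⊗≫ 𝟙 _ := by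
        rw [whisker_exchange, whisker_exchange]; monoidal
    _ = _ := by
        rw [whisker_exchange, whisker_exchange, BraidedCategory.braiding_tensor_left_hom]
        monoidal

/-- The compatibility condition of a right-right Yetter-Drinfel'd module:
`(y h₍₂₎)₍₀₎ ⊗ h₍₁₎ (y h₍₂₎)₍₁₎ = y₍₀₎ h₍₁₎ ⊗ y₍₁₎ h₍₂₎`, where the two strands that pass
the object on the left-hand side do so by the braidings `β_ Y H` and `β_ H Y`. -/
def IsYD [BimonObj H] {Y : C} (b : Y ⊗ H ⟶ Y) (s : Y ⟶ Y ⊗ H) : Prop :=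
  Y ◁ Δ[H] ≫ (α_ Y H H).inv ≫ (β_ Y H).hom ▷ H ≫ (α_ H Y H).hom ≫ H ◁ (b ≫ s) ≫
      (α_ H Y H).inv ≫ (β_ H Y).hom ▷ H ≫ (α_ Y H H).hom ≫ Y ◁ μ[H] =
    (s ⊗ₘ Δ[H]) ≫ tensorμ Y H H H ≫ (b ⊗ₘ μ[H])

theorem ydBraid_natural_left {X X' Y : C} {a : X ⊗ H ⟶ X} {a' : X' ⊗ H ⟶ X'} {f : X ⟶ X'}
    (hf : a ≫ f = f ▷ H ≫ a') (s : Y ⟶ Y ⊗ H) :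
    f ▷ Y ≫ ydBraid a' s = ydBraid a s ≫ Y ◁ f := by
  simp only [ydBraid]
  calc
    _ = 𝟙 _ ⊗≫ (f ▷ Y ≫ X' ◁ s) ⊗≫ (β_ X' Y).hom ▷ H ⊗≫ Y ◁ a' ⊗≫ 𝟙 _ := by monoidal
    _ = 𝟙 _ ⊗≫ X ◁ s ⊗≫ (f ▷ Y ≫ (β_ X' Y).hom) ▷ H ⊗≫ Y ◁ a' ⊗≫ 𝟙 _ := by
        rw [← whisker_exchange]; monoidal
    _ = 𝟙 _ ⊗≫ X ◁ s ⊗≫ (β_ X Y).hom ▷ H ⊗≫ Y ◁ (f ▷ H ≫ a') ⊗≫ 𝟙 _ := by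
        rw [BraidedCategory.braiding_naturality_left]; monoidal
    _ = _ := by rw [← hf]; monoidal

theorem ydBraid_natural_right {X Y Y' : C} (a : X ⊗ H ⟶ X) {s : Y ⟶ Y ⊗ H} {s' : Y' ⟶ Y' ⊗ H}
    {g : Y ⟶ Y'} (hg : s ≫ g ▷ H = g ≫ s') :
    X ◁ g ≫ ydBraid a s' = ydBraid a s ≫ g ▷ X := by
  simp only [ydBraid]
  calc
    _ = 𝟙 _ ⊗≫ X ◁ (g ≫ s') ⊗≫ (β_ X Y').hom ▷ H ⊗≫ Y' ◁ a ⊗≫ 𝟙 _ := by monoidal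
    _ = 𝟙 _ ⊗≫ X ◁ s ⊗≫ (X ◁ g ≫ (β_ X Y').hom) ▷ H ⊗≫ Y' ◁ a ⊗≫ 𝟙 _ := by
        rw [← hg]; monoidal
    _ = 𝟙 _ ⊗≫ X ◁ s ⊗≫ (β_ X Y).hom ▷ H ⊗≫ (g ▷ (X ⊗ H) ≫ Y' ◁ a) ⊗≫ 𝟙 _ := by
        rw [BraidedCategory.braiding_naturality_right]; monoidal
    _ = _ := by rw [← whisker_exchange]; monoidal

theorem ydBraid_linear [BimonObj H] {X Y : C} {a : X ⊗ H ⟶ X} (ha : IsAction a)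
    {b : Y ⊗ H ⟶ Y} {s : Y ⟶ Y ⊗ H} (h : IsYD b s) :
    diagAct a b ≫ ydBraid a s = ydBraid a s ▷ H ≫ diagAct b a := by
  simp only [IsYD, tensorμ, MonoidalCategory.tensorHom_def] at h
  simp only [ydBraid, diagAct, tensorμ, MonoidalCategory.tensorHom_def]
  calc
    _ = 𝟙 _ ⊗≫ X ◁ Y ◁ Δ[H] ⊗≫ X ◁ (β_ Y H).hom ▷ H ⊗≫ (a ▷ (Y ⊗ H) ≫ X ◁ (b ≫ s)) ⊗≫
          (β_ X Y).hom ▷ H ⊗≫ Y ◁ a ⊗≫ 𝟙 _ := by monoidal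
    _ = 𝟙 _ ⊗≫ X ◁ Y ◁ Δ[H] ⊗≫ X ◁ (β_ Y H).hom ▷ H ⊗≫ X ◁ H ◁ (b ≫ s) ⊗≫
          (a ▷ Y ≫ (β_ X Y).hom) ▷ H ⊗≫ Y ◁ a ⊗≫ 𝟙 _ := by
        rw [← whisker_exchange]; monoidal
    _ = 𝟙 _ ⊗≫ X ◁ Y ◁ Δ[H] ⊗≫ X ◁ (β_ Y H).hom ▷ H ⊗≫ X ◁ H ◁ (b ≫ s) ⊗≫
          X ◁ (β_ H Y).hom ▷ H ⊗≫ (β_ X Y).hom ▷ H ▷ H ⊗≫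
          Y ◁ ((α_ X H H).inv ≫ a ▷ H ≫ a) ⊗≫ 𝟙 _ := by
        rw [BraidedCategory.braiding_naturality_left, BraidedCategory.braiding_tensor_left_hom]
        monoidal
    _ = 𝟙 _ ⊗≫ X ◁ Y ◁ Δ[H] ⊗≫ X ◁ (β_ Y H).hom ▷ H ⊗≫ X ◁ H ◁ (b ≫ s) ⊗≫
          X ◁ (β_ H Y).hom ▷ H ⊗≫ ((β_ X Y).hom ▷ (H ⊗ H) ≫ (Y ⊗ X) ◁ μ[H]) ⊗≫ Y ◁ a ⊗≫ 𝟙 _ := by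
        rw [← ha.mul]; monoidal
    _ = 𝟙 _ ⊗≫ X ◁ (Y ◁ Δ[H] ≫ (α_ Y H H).inv ≫ (β_ Y H).hom ▷ H ≫ (α_ H Y H).hom ≫
          H ◁ (b ≫ s) ≫ (α_ H Y H).inv ≫ (β_ H Y).hom ▷ H ≫ (α_ Y H H).hom ≫ Y ◁ μ[H]) ⊗≫
          (β_ X Y).hom ▷ H ⊗≫ Y ◁ a ⊗≫ 𝟙 _ := by
        rw [← whisker_exchange]; monoidal
    _ = 𝟙 _ ⊗≫ X ◁ (s ▷ H ≫ (Y ⊗ H) ◁ Δ[H]) ⊗≫ X ◁ Y ◁ (β_ H H).hom ▷ H ⊗≫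
          X ◁ (b ▷ (H ⊗ H) ≫ Y ◁ μ[H]) ⊗≫ (β_ X Y).hom ▷ H ⊗≫ Y ◁ a ⊗≫ 𝟙 _ := by
        rw [h]; monoidal
    _ = 𝟙 _ ⊗≫ X ◁ (s ▷ H ≫ (Y ⊗ H) ◁ Δ[H]) ⊗≫ X ◁ Y ◁ (β_ H H).hom ▷ H ⊗≫
          (X ◁ (Y ⊗ H) ◁ μ[H]) ⊗≫ (X ◁ b ≫ (β_ X Y).hom) ▷ H ⊗≫ Y ◁ a ⊗≫ 𝟙 _ := by
        rw [← whisker_exchange b μ[H]]; monoidal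
    _ = 𝟙 _ ⊗≫ X ◁ (s ▷ H ≫ (Y ⊗ H) ◁ Δ[H]) ⊗≫ X ◁ Y ◁ (β_ H H).hom ▷ H ⊗≫
          ((X ⊗ Y) ◁ (H ◁ μ[H]) ≫ (β_ X Y).hom ▷ (H ⊗ H)) ⊗≫ Y ◁ (β_ X H).hom ▷ H ⊗≫
          (b ▷ (X ⊗ H) ≫ Y ◁ a) ⊗≫ 𝟙 _ := by
        rw [BraidedCategory.braiding_naturality_right, BraidedCategory.braiding_tensor_right_hom]
        monoidal
    _ = 𝟙 _ ⊗≫ X ◁ (s ▷ H ≫ (Y ⊗ H) ◁ Δ[H]) ⊗≫ X ◁ Y ◁ (β_ H H).hom ▷ H ⊗≫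
          (β_ X Y).hom ▷ H ▷ H ▷ H ⊗≫ Y ◁ ((X ⊗ H) ◁ μ[H] ≫ (β_ X H).hom ▷ H) ⊗≫
          Y ◁ H ◁ a ⊗≫ b ▷ X ⊗≫ 𝟙 _ := by
        rw [whisker_exchange (β_ X Y).hom, ← whisker_exchange b a]; monoidal
    _ = 𝟙 _ ⊗≫ X ◁ s ▷ H ⊗≫ (X ⊗ Y) ◁ H ◁ Δ[H] ⊗≫ ((X ⊗ Y) ◁ (β_ H H).hom ▷ H ≫
          (β_ X Y).hom ▷ ((H ⊗ H) ⊗ H)) ⊗≫ Y ◁ (β_ X H).hom ▷ H ▷ H ⊗≫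
          Y ◁ H ◁ (X ◁ μ[H] ≫ a) ⊗≫ b ▷ X ⊗≫ 𝟙 _ := by
        rw [whisker_exchange (β_ X H).hom]; monoidal
    _ = 𝟙 _ ⊗≫ X ◁ s ▷ H ⊗≫ ((X ⊗ Y) ◁ H ◁ Δ[H] ≫ (β_ X Y).hom ▷ (H ⊗ H ⊗ H)) ⊗≫
          Y ◁ (X ◁ (β_ H H).hom ⊗≫ (β_ X H).hom ▷ H) ▷ H ⊗≫
          Y ◁ H ◁ (a ▷ H ≫ a) ⊗≫ b ▷ X ⊗≫ 𝟙 _ := by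
        rw [whisker_exchange, ha.mul]; monoidal
    _ = 𝟙 _ ⊗≫ X ◁ s ▷ H ⊗≫ (β_ X Y).hom ▷ H ▷ H ⊗≫ Y ◁ ((X ⊗ H) ◁ Δ[H]) ⊗≫
          Y ◁ ((β_ (X ⊗ H) H).hom ≫ H ◁ a) ▷ H ⊗≫
          (Y ⊗ H) ◁ a ⊗≫ b ▷ X ⊗≫ 𝟙 _ := by
        rw [whisker_exchange, BraidedCategory.braiding_tensor_left_hom]; monoidal
    _ = 𝟙 _ ⊗≫ X ◁ s ▷ H ⊗≫ (β_ X Y).hom ▷ H ▷ H ⊗≫ Y ◁ ((X ⊗ H) ◁ Δ[H] ≫ a ▷ (H ⊗ H)) ⊗≫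
          Y ◁ (β_ X H).hom ▷ H ⊗≫
          ((Y ⊗ H) ◁ a ≫ b ▷ X) ⊗≫ 𝟙 _ := by
        rw [← BraidedCategory.braiding_naturality_left]; monoidal
    _ = _ := by
        rw [whisker_exchange, whisker_exchange]; monoidal

theorem isYD_of_linear [BimonObj H] {Y : C} {b : Y ⊗ H ⟶ Y} {s : Y ⟶ Y ⊗ H}
    (h : diagAct μ[H] b ≫ ydBraid μ[H] s = ydBraid μ[H] s ▷ H ≫ diagAct b μ[H]) :
    IsYD b s := by
  have h' : 𝟙 _ ⊗≫ η[H] ▷ Y ▷ H ⊗≫ (diagAct μ[H] b ≫ ydBraid μ[H] s) ⊗≫ 𝟙 (Y ⊗ H) =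
    𝟙 (Y ⊗ H) ⊗≫ η[H] ▷ Y ▷ H ⊗≫ (ydBraid μ[H] s ▷ H ≫ diagAct b μ[H]) ⊗≫ 𝟙 _ := by rw [h]
  simp only [ydBraid, diagAct, tensorμ, MonoidalCategory.tensorHom_def] at h'
  simp only [IsYD, tensorμ, MonoidalCategory.tensorHom_def]
  refine Eq.trans ?_ (h'.trans ?_)
  · symm
    calc
      _ = 𝟙 _ ⊗≫ (η[H] ▷ (Y ⊗ H) ≫ H ◁ (Y ◁ Δ[H] ≫ (α_ Y H H).inv ≫ (β_ Y H).hom ▷ H)) ⊗≫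
            μ[H] ▷ Y ▷ H ⊗≫ H ◁ (b ≫ s) ⊗≫ (β_ H Y).hom ▷ H ⊗≫ Y ◁ μ[H] := by monoidal
      _ = 𝟙 _ ⊗≫ (Y ◁ Δ[H] ≫ (α_ Y H H).inv ≫ (β_ Y H).hom ▷ H) ⊗≫ (η[H] ▷ H ≫ μ[H]) ▷ Y ▷ H ⊗≫
            H ◁ (b ≫ s) ⊗≫ (β_ H Y).hom ▷ H ⊗≫ Y ◁ μ[H] := by
          rw [← whisker_exchange]; monoidal
      _ = _ := by rw [MonObj.one_mul]; monoidal
  · calc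
      _ = 𝟙 _ ⊗≫ (η[H] ▷ Y ≫ H ◁ s) ▷ H ⊗≫ (β_ H Y).hom ▷ H ▷ H ⊗≫ Y ◁ μ[H] ▷ H ⊗≫
            Y ◁ H ◁ Δ[H] ⊗≫ Y ◁ (β_ H H).hom ▷ H ⊗≫ b ▷ (H ⊗ H) ⊗≫ Y ◁ μ[H] := by monoidal
      _ = 𝟙 _ ⊗≫ s ▷ H ⊗≫ (η[H] ▷ Y ≫ (β_ H Y).hom) ▷ H ▷ H ⊗≫ Y ◁ μ[H] ▷ H ⊗≫
            Y ◁ H ◁ Δ[H] ⊗≫ Y ◁ (β_ H H).hom ▷ H ⊗≫ b ▷ (H ⊗ H) ⊗≫ Y ◁ μ[H] := by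
          rw [← whisker_exchange]; monoidal
      _ = 𝟙 _ ⊗≫ s ▷ H ⊗≫ Y ◁ (η[H] ▷ H ≫ μ[H]) ▷ H ⊗≫
            Y ◁ H ◁ Δ[H] ⊗≫ Y ◁ (β_ H H).hom ▷ H ⊗≫ b ▷ (H ⊗ H) ⊗≫ Y ◁ μ[H] := by
          rw [BraidedCategory.braiding_naturality_left, braiding_tensorUnit_left]; monoidal
      _ = _ := by rw [MonObj.one_mul]; monoidal

theorem IsYD.diag [BimonObj H] {Y Z : C} {b : Y ⊗ H ⟶ Y} {s : Y ⟶ Y ⊗ H} {c : Z ⊗ H ⟶ Z}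
    {t : Z ⟶ Z ⊗ H} (hb : IsAction b) (hc : IsAction c) (h : IsYD b s) (h' : IsYD c t) :
    IsYD (diagAct b c) (diagCoact s t) := by
  apply isYD_of_linear
  let X : RMod H := ⟨H, μ[H], isAction_mul⟩
  let Y' : RMod H := ⟨Y, b, hb⟩
  let Z' : RMod H := ⟨Z, c, hc⟩
  let f : X ⊗ Y' ⟶ Y' ⊗ X := ⟨ydBraid μ[H] s, ydBraid_linear isAction_mul h⟩
  let g : X ⊗ Z' ⟶ Z' ⊗ X := ⟨ydBraid μ[H] t, ydBraid_linear isAction_mul h'⟩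
  have key := ydBraid_hexagon_forward (isAction_mul (A := H)) s t
  rw [← Iso.eq_inv_comp, ← Iso.eq_comp_inv] at key
  rw [key]
  exact (((α_ X Y' Z').inv ≫ f ▷ Z' ≫ (α_ Y' X Z').hom ≫ Y' ◁ g) ≫ (α_ Y' Z' X).inv).linear

variable (H) in
/-- The trivial coaction on the unit object, given by the unit of `H`. -/
def unitCoact [MonObj H] : 𝟙_ C ⟶ 𝟙_ C ⊗ H := η[H] ≫ (λ_ H).inv

theorem ydBraid_unit [BimonObj H] {X : C} {a : X ⊗ H ⟶ X} (ha : IsAction a) :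
    ydBraid a (unitCoact H) = (ρ_ X).hom ≫ (λ_ X).inv := by
  simp only [ydBraid, unitCoact]
  calc
    _ = 𝟙 _ ⊗≫ X ◁ η[H] ⊗≫ a ⊗≫ 𝟙 _ := by rw [braiding_tensorUnit_right]; monoidal
    _ = 𝟙 _ ⊗≫ (X ◁ η[H] ≫ a) ⊗≫ 𝟙 _ := by monoidal
    _ = _ := by rw [ha.one]; monoidal

theorem isYD_unit [BimonObj H] : IsYD (unitAct H) (unitCoact H) := by
  apply isYD_of_linear
  rw [ydBraid_unit isAction_mul]
  let X : RMod H := ⟨H, μ[H], isAction_mul⟩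
  exact ((ρ_ X).hom ≫ (λ_ X).inv).linear

theorem isCoaction_unit [BimonObj H] : IsCoaction (unitCoact H) where
  counit := by
    simp only [unitCoact, Category.assoc]
    rw [← leftUnitor_inv_naturality, BimonObj.one_counit_assoc]; monoidal
  comul := by
    simp only [unitCoact, Category.assoc]
    rw [← leftUnitor_inv_naturality, BimonObj.one_comul_assoc, MonObj.tensorObj.one_def,
      MonoidalCategory.tensorHom_def']
    monoidal

theorem ydBraid_colinear [BimonObj H] {X Y : C} {a : X ⊗ H ⟶ X} {r : X ⟶ X ⊗ H}
    {s : Y ⟶ Y ⊗ H} (hs : IsCoaction s) (h : IsYD a r) :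
    ydBraid a s ≫ diagCoact s r = diagCoact r s ≫ ydBraid a s ▷ H := by
  simp only [IsYD, tensorμ, MonoidalCategory.tensorHom_def'] at h
  simp only [ydBraid, diagCoact, tensorμ, MonoidalCategory.tensorHom_def]
  calc
    _ = 𝟙 _ ⊗≫ X ◁ s ⊗≫ (β_ X Y).hom ▷ H ⊗≫ (Y ◁ a ≫ s ▷ X) ⊗≫ Y ◁ H ◁ r ⊗≫
          Y ◁ (β_ H X).hom ▷ H ⊗≫ Y ◁ X ◁ μ[H] ⊗≫ 𝟙 _ := by monoidal
    _ = 𝟙 _ ⊗≫ X ◁ s ⊗≫ ((β_ X Y).hom ≫ s ▷ X) ▷ H ⊗≫ Y ◁ H ◁ (a ≫ r) ⊗≫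
          Y ◁ (β_ H X).hom ▷ H ⊗≫ Y ◁ X ◁ μ[H] ⊗≫ 𝟙 _ := by
        rw [whisker_exchange]; monoidal
    _ = 𝟙 _ ⊗≫ X ◁ (s ≫ s ▷ H ≫ (α_ Y H H).hom) ⊗≫ (β_ X Y).hom ▷ H ▷ H ⊗≫
          Y ◁ (β_ X H).hom ▷ H ⊗≫ Y ◁ H ◁ (a ≫ r) ⊗≫
          Y ◁ (β_ H X).hom ▷ H ⊗≫ Y ◁ X ◁ μ[H] ⊗≫ 𝟙 _ := by
        rw [← BraidedCategory.braiding_naturality_right,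
          BraidedCategory.braiding_tensor_right_hom]
        monoidal
    _ = 𝟙 _ ⊗≫ X ◁ s ⊗≫ ((X ⊗ Y) ◁ Δ[H] ≫ (β_ X Y).hom ▷ (H ⊗ H)) ⊗≫
          Y ◁ (β_ X H).hom ▷ H ⊗≫ Y ◁ H ◁ (a ≫ r) ⊗≫
          Y ◁ (β_ H X).hom ▷ H ⊗≫ Y ◁ X ◁ μ[H] ⊗≫ 𝟙 _ := by
        rw [← hs.comul]; monoidal
    _ = 𝟙 _ ⊗≫ X ◁ s ⊗≫ (β_ X Y).hom ▷ H ⊗≫ Y ◁ (X ◁ Δ[H] ≫ (α_ X H H).inv ≫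
          (β_ X H).hom ▷ H ≫ (α_ H X H).hom ≫ H ◁ (a ≫ r) ≫
          (α_ H X H).inv ≫ (β_ H X).hom ▷ H ≫ (α_ X H H).hom ≫ X ◁ μ[H]) ⊗≫ 𝟙 _ := by
        rw [whisker_exchange]; monoidal
    _ = 𝟙 _ ⊗≫ X ◁ s ⊗≫ (β_ X Y).hom ▷ H ⊗≫ Y ◁ (X ◁ Δ[H] ≫ r ▷ (H ⊗ H)) ⊗≫
          Y ◁ X ◁ (β_ H H).hom ▷ H ⊗≫ Y ◁ ((X ⊗ H) ◁ μ[H] ≫ a ▷ H) ⊗≫ 𝟙 _ := by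
        rw [h]; monoidal
    _ = 𝟙 _ ⊗≫ X ◁ s ⊗≫ ((β_ X Y).hom ≫ Y ◁ r) ▷ H ⊗≫ Y ◁ X ◁ H ◁ Δ[H] ⊗≫
          Y ◁ X ◁ (β_ H H).hom ▷ H ⊗≫ Y ◁ ((X ⊗ H) ◁ μ[H] ≫ a ▷ H) ⊗≫ 𝟙 _ := by
        rw [whisker_exchange]; monoidal
    _ = 𝟙 _ ⊗≫ (X ◁ s ≫ r ▷ (Y ⊗ H)) ⊗≫ X ◁ (β_ H Y).hom ▷ H ⊗≫
          ((β_ X Y).hom ▷ (H ⊗ H) ≫ (Y ⊗ X) ◁ H ◁ Δ[H]) ⊗≫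
          Y ◁ X ◁ (β_ H H).hom ▷ H ⊗≫ Y ◁ ((X ⊗ H) ◁ μ[H] ≫ a ▷ H) ⊗≫ 𝟙 _ := by
        rw [← BraidedCategory.braiding_naturality_left, BraidedCategory.braiding_tensor_left_hom]
        monoidal
    _ = 𝟙 _ ⊗≫ r ▷ Y ⊗≫ X ◁ H ◁ s ⊗≫ X ◁ ((β_ H Y).hom ▷ H ≫ (Y ⊗ H) ◁ Δ[H]) ⊗≫
          ((β_ X Y).hom ▷ ((H ⊗ H) ⊗ H) ≫
          (Y ⊗ X) ◁ (β_ H H).hom ▷ H) ⊗≫ Y ◁ ((X ⊗ H) ◁ μ[H] ≫ a ▷ H) ⊗≫ 𝟙 _ := by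
        rw [whisker_exchange, ← whisker_exchange (β_ X Y).hom]; monoidal
    _ = 𝟙 _ ⊗≫ r ▷ Y ⊗≫ X ◁ H ◁ (s ≫ Y ◁ Δ[H]) ⊗≫ X ◁ (β_ H Y).hom ▷ H ▷ H ⊗≫
          X ◁ Y ◁ (β_ H H).hom ▷ H ⊗≫ ((β_ X Y).hom ▷ (H ⊗ H ⊗ H) ≫
          (Y ⊗ X) ◁ H ◁ μ[H]) ⊗≫ Y ◁ a ▷ H ⊗≫ 𝟙 _ := by
        rw [← whisker_exchange (β_ H Y).hom, ← whisker_exchange (β_ X Y).hom]; monoidal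
    _ = 𝟙 _ ⊗≫ r ▷ Y ⊗≫ X ◁ H ◁ s ⊗≫ X ◁ (H ◁ s ≫ (β_ H (Y ⊗ H)).hom) ▷ H ⊗≫
          X ◁ Y ◁ H ◁ μ[H] ⊗≫ (β_ X Y).hom ▷ H ▷ H ⊗≫ Y ◁ a ▷ H ⊗≫ 𝟙 _ := by
        rw [hs.comul, ← whisker_exchange (β_ X Y).hom, BraidedCategory.braiding_tensor_right_hom]
        monoidal
    _ = 𝟙 _ ⊗≫ r ▷ Y ⊗≫ X ◁ H ◁ s ⊗≫ X ◁ (β_ H Y).hom ▷ H ⊗≫ X ◁ (s ▷ (H ⊗ H) ≫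
          (Y ⊗ H) ◁ μ[H]) ⊗≫ (β_ X Y).hom ▷ H ▷ H ⊗≫ Y ◁ a ▷ H ⊗≫ 𝟙 _ := by
        rw [BraidedCategory.braiding_naturality_right]; monoidal
    _ = _ := by
        rw [← whisker_exchange s μ[H]]; monoidal

end Coactions

section CoactionsTensor
variable {C : Type u} [Category.{v} C] [MonoidalCategory C] [BraidedCategory C] {H : C}

theorem diagCoact_natural [MonObj H] {X Y X' Y' : C} {r : X ⟶ X ⊗ H} {s : Y ⟶ Y ⊗ H}
    {r' : X' ⟶ X' ⊗ H} {s' : Y' ⟶ Y' ⊗ H} {f : X ⟶ X'} {g : Y ⟶ Y'}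
    (hf : r ≫ f ▷ H = f ≫ r') (hg : s ≫ g ▷ H = g ≫ s') :
    diagCoact r s ≫ (f ⊗ₘ g) ▷ H = (f ⊗ₘ g) ≫ diagCoact r' s' := by
  simp only [diagCoact, Category.assoc, tensorHom_comp_tensorHom_assoc, ← hf, ← hg]
  rw [← tensorHom_comp_tensorHom, Category.assoc, ← tensorHom_id f, ← tensorHom_id g,
    tensorμ_natural_assoc, id_tensorHom_id, tensorHom_id, whisker_exchange]

theorem IsCoaction.diag [BimonObj H] {X Y : C} {r : X ⟶ X ⊗ H} {s : Y ⟶ Y ⊗ H}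
    (hr : IsCoaction r) (hs : IsCoaction s) : IsCoaction (diagCoact r s) where
  counit := by
    simp only [diagCoact, Category.assoc, ← whiskerLeft_comp, BimonObj.mul_counit]
    rw [Comon.tensorObj_counit, whiskerLeft_comp, ← id_tensorHom (X ⊗ Y) (ε[H] ⊗ₘ ε[H]),
      ← id_tensorHom_id, ← tensorμ_natural_assoc, id_tensorHom, id_tensorHom,
      tensorHom_comp_tensorHom_assoc, hr.counit, hs.counit]
    rw [← cancel_mono (ρ_ (X ⊗ Y)).hom, Iso.inv_hom_id, Category.assoc, Category.assoc,
      ← rightUnitor_monoidal, tensorHom_comp_tensorHom]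
    simp
  comul := by
    have ext : (r ⊗ₘ s) ≫ tensorμ X H Y H ≫ (X ⊗ Y) ◁ ((Δ[H] ⊗ₘ Δ[H]) ≫ tensorμ H H H H) =
        (r ⊗ₘ s) ≫ tensorμ X H Y H ≫ ((r ⊗ₘ s) ≫ tensorμ X H Y H) ▷ (H ⊗ H) ≫
          (α_ _ _ _).hom := by
      rw [comp_whiskerRight, Category.assoc, ← tensorHom_id (r ⊗ₘ s), ← id_tensorHom_id,
        ← tensorμ_natural_assoc, associator_monoidal, tensorHom_comp_tensorHom_assoc,
        tensorHom_comp_tensorHom_assoc, whiskerLeft_comp, ← id_tensorHom (X ⊗ Y) (Δ ⊗ₘ Δ),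
        ← id_tensorHom_id, ← tensorμ_natural_assoc, tensorHom_comp_tensorHom_assoc]
      simp only [id_tensorHom, tensorHom_id, hr.comul, hs.comul, Category.assoc]
    simp only [diagCoact, Category.assoc]
    rw [← whiskerLeft_comp, BimonObj.mul_comul, ← Category.assoc (Δ[H] ⊗ₘ Δ[H]),
      whiskerLeft_comp, reassoc_of% ext]
    have e : (X ⊗ Y) ◁ μ[H] ≫ ((r ⊗ₘ s) ≫ tensorμ X H Y H ≫ (X ⊗ Y) ◁ μ[H]) ▷ H ≫
        (α_ (X ⊗ Y) H H).hom =
        ((r ⊗ₘ s) ≫ tensorμ X H Y H) ▷ (H ⊗ H) ≫ (α_ _ _ _).hom ≫ (X ⊗ Y) ◁ (μ ⊗ₘ μ) := by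
      rw [← Category.assoc (r ⊗ₘ s), comp_whiskerRight, Category.assoc, whisker_exchange_assoc,
        MonoidalCategory.tensorHom_def' μ[H] μ[H]]
      monoidal
    rw [e]

theorem diagCoact_associator [MonObj H] {X Y Z : C} (r : X ⟶ X ⊗ H) (s : Y ⟶ Y ⊗ H)
    (t : Z ⟶ Z ⊗ H) :
    diagCoact (diagCoact r s) t ≫ (α_ X Y Z).hom ▷ H =
      (α_ X Y Z).hom ≫ diagCoact r (diagCoact s t) := by
  have h1 : diagCoact (diagCoact r s) t = ((r ⊗ₘ s) ⊗ₘ t) ≫ tensorμ X H Y H ▷ (Z ⊗ H) ≫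
      tensorμ (X ⊗ Y) (H ⊗ H) Z H ≫ _ ◁ (μ ▷ H ≫ μ) := by
    have : diagCoact r s ⊗ₘ t = ((r ⊗ₘ s) ⊗ₘ t) ≫ tensorμ X H Y H ▷ (Z ⊗ H) ≫
        ((X ⊗ Y) ◁ μ ⊗ₘ Z ◁ 𝟙 H) := by
      rw [← tensorHom_id, tensorHom_comp_tensorHom, tensorHom_comp_tensorHom, diagCoact]; simp
    rw [diagCoact, this, Category.assoc, Category.assoc, ← id_tensorHom, ← id_tensorHom,
      tensorμ_natural_assoc, id_tensorHom_id, id_tensorHom, tensorHom_id, whiskerLeft_comp]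
  have h2 : diagCoact r (diagCoact s t) = (r ⊗ₘ (s ⊗ₘ t)) ≫ (X ⊗ H) ◁ tensorμ Y H Z H ≫
      tensorμ X H (Y ⊗ Z) (H ⊗ H) ≫ _ ◁ (H ◁ μ ≫ μ) := by
    have : r ⊗ₘ diagCoact s t = (r ⊗ₘ (s ⊗ₘ t)) ≫ (X ⊗ H) ◁ tensorμ Y H Z H ≫
        (X ◁ 𝟙 H ⊗ₘ (Y ⊗ Z) ◁ μ) := by
      rw [← id_tensorHom (X ⊗ H), tensorHom_comp_tensorHom, tensorHom_comp_tensorHom, diagCoact]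
      simp
    rw [diagCoact, this, Category.assoc, Category.assoc, ← id_tensorHom X (𝟙 H),
      ← id_tensorHom (Y ⊗ Z) μ[H], tensorμ_natural_assoc, id_tensorHom_id, id_tensorHom,
      id_tensorHom, whiskerLeft_comp]
  rw [h1, h2, ← associator_naturality_assoc, ← tensor_associativity_assoc,
    MonoidalCategory.tensorHom_def (α_ X Y Z).hom]
  simp only [Category.assoc, ← whiskerLeft_comp, ← MonObj.mul_assoc]
  rw [whisker_exchange]

theorem diagCoact_leftUnitor [BimonObj H] {X : C} (r : X ⟶ X ⊗ H) :
    diagCoact (unitCoact H) r ≫ (λ_ X).hom ▷ H = (λ_ X).hom ≫ r := by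
  simp only [diagCoact, unitCoact, tensorμ, MonoidalCategory.tensorHom_def']
  calc
    _ = 𝟙 _ ⊗≫ r ⊗≫ (η[H] ▷ X ≫ (β_ H X).hom) ▷ H ⊗≫ X ◁ μ[H] ⊗≫ 𝟙 _ := by monoidal
    _ = 𝟙 _ ⊗≫ r ⊗≫ X ◁ (η[H] ▷ H ≫ μ[H]) ⊗≫ 𝟙 _ := by
      rw [BraidedCategory.braiding_naturality_left, braiding_tensorUnit_left]; monoidal
    _ = _ := by rw [MonObj.one_mul]; monoidal

theorem diagCoact_rightUnitor [BimonObj H] {X : C} (r : X ⟶ X ⊗ H) :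
    diagCoact r (unitCoact H) ≫ (ρ_ X).hom ▷ H = (ρ_ X).hom ≫ r := by
  simp only [diagCoact, unitCoact, tensorμ, MonoidalCategory.tensorHom_def]
  calc
    _ = 𝟙 _ ⊗≫ r ⊗≫ X ◁ (H ◁ η[H] ⊗≫ (β_ H (𝟙_ C)).hom ▷ H) ⊗≫ X ◁ μ[H] ⊗≫ 𝟙 _ := by monoidal
    _ = 𝟙 _ ⊗≫ r ⊗≫ X ◁ (H ◁ η[H] ≫ μ[H]) ⊗≫ 𝟙 _ := by
      rw [braiding_tensorUnit_right]; monoidal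
    _ = _ := by rw [MonObj.mul_one]; monoidal

/-- The morphism `y ⊗ x ↦ y₍₀₎ ⊗ x f(y₍₁₎)`, with the inverse braiding. -/
def twist {X Y : C} (a : X ⊗ H ⟶ X) (s : Y ⟶ Y ⊗ H) (f : H ⟶ H) : Y ⊗ X ⟶ Y ⊗ X :=
  s ▷ X ≫ (α_ Y H X).hom ≫ Y ◁ (f ▷ X ≫ (β_ X H).inv ≫ a)

theorem ydBraid_eq_twist {X Y : C} (a : X ⊗ H ⟶ X) (s : Y ⟶ Y ⊗ H) :
    ydBraid a s = (β_ X Y).hom ≫ twist a s (𝟙 H) := by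
  simp only [ydBraid, twist]
  rw [← BraidedCategory.braiding_naturality_right_assoc,
    BraidedCategory.braiding_tensor_right_hom]
  simp

theorem twist_comp [BimonObj H] {X Y : C} {a : X ⊗ H ⟶ X} {s : Y ⟶ Y ⊗ H} (ha : IsAction a)
    (hs : IsCoaction s) (f g : H ⟶ H) :
    twist a s f ≫ twist a s g = twist a s (Δ[H] ≫ (g ⊗ₘ f) ≫ (β_ H H).inv ≫ μ[H]) := by
  simp only [twist, MonoidalCategory.tensorHom_def]
  calc
    _ = 𝟙 _ ⊗≫ s ▷ X ⊗≫ (Y ◁ (f ▷ X ≫ (β_ X H).inv ≫ a) ≫ s ▷ X) ⊗≫ Y ◁ g ▷ X ⊗≫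
          Y ◁ (β_ X H).inv ⊗≫ Y ◁ a ⊗≫ 𝟙 _ := by monoidal
    _ = 𝟙 _ ⊗≫ (s ≫ s ▷ H ≫ (α_ Y H H).hom) ▷ X ⊗≫
          Y ◁ (H ◁ (f ▷ X ≫ (β_ X H).inv ≫ a) ≫ g ▷ X) ⊗≫
          Y ◁ (β_ X H).inv ⊗≫ Y ◁ a ⊗≫ 𝟙 _ := by
        rw [whisker_exchange]; monoidal
    _ = 𝟙 _ ⊗≫ s ▷ X ⊗≫ Y ◁ Δ[H] ▷ X ⊗≫ Y ◁ g ▷ H ▷ X ⊗≫ Y ◁ H ◁ f ▷ X ⊗≫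
          Y ◁ H ◁ (β_ X H).inv ⊗≫ Y ◁ (H ◁ a ≫ (β_ X H).inv) ⊗≫ Y ◁ a ⊗≫ 𝟙 _ := by
        rw [← hs.comul, whisker_exchange]; monoidal
    _ = 𝟙 _ ⊗≫ s ▷ X ⊗≫ Y ◁ Δ[H] ▷ X ⊗≫ Y ◁ g ▷ H ▷ X ⊗≫ Y ◁ H ◁ f ▷ X ⊗≫
          Y ◁ (H ◁ (β_ X H).inv ≫ (β_ (X ⊗ H) H).inv) ⊗≫ Y ◁ ((α_ X H H).inv ≫ a ▷ H ≫ a)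
          ⊗≫ 𝟙 _ := by
        rw [BraidedCategory.braiding_inv_naturality_right]; monoidal
    _ = 𝟙 _ ⊗≫ s ▷ X ⊗≫ Y ◁ Δ[H] ▷ X ⊗≫ Y ◁ g ▷ H ▷ X ⊗≫ Y ◁ H ◁ f ▷ X ⊗≫
          Y ◁ ((β_ H H).inv ▷ X ⊗≫ H ◁ (β_ X H).inv ⊗≫ (β_ X H).inv ▷ H) ⊗≫
          Y ◁ ((α_ X H H).inv ≫ a ▷ H ≫ a) ⊗≫ 𝟙 _ := by
        rw [BraidedCategory.braiding_inv_naturality_right,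
          BraidedCategory.braiding_tensor_left_inv]
        monoidal
    _ = 𝟙 _ ⊗≫ s ▷ X ⊗≫ Y ◁ (Δ[H] ≫ g ▷ H ≫ H ◁ f ≫ (β_ H H).inv) ▷ X ⊗≫
          Y ◁ ((β_ X (H ⊗ H)).inv ≫ X ◁ μ[H] ≫ a) ⊗≫ 𝟙 _ := by
        rw [ha.mul, BraidedCategory.braiding_tensor_right_inv]; monoidal
    _ = _ := by
        rw [← BraidedCategory.braiding_inv_naturality_left_assoc]; monoidal

theorem twist_one [BimonObj H] {X Y : C} {a : X ⊗ H ⟶ X} {s : Y ⟶ Y ⊗ H} (ha : IsAction a)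
    (hs : IsCoaction s) : twist a s (ε[H] ≫ η[H]) = 𝟙 _ := by
  simp only [twist]
  calc
    _ = 𝟙 _ ⊗≫ (s ≫ Y ◁ ε[H]) ▷ X ⊗≫ Y ◁ (η[H] ▷ X ≫ (β_ X H).inv ≫ a) ⊗≫ 𝟙 _ := by monoidal
    _ = 𝟙 _ ⊗≫ Y ◁ (X ◁ η[H] ≫ a) ⊗≫ 𝟙 _ := by
      rw [BraidedCategory.braiding_inv_naturality_left_assoc, hs.counit,
        braiding_inv_tensorUnit_right]; monoidal
    _ = _ := by rw [ha.one]; monoidal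

theorem antipode_inv_left [HopfObj H] [IsIso 𝒮[H]] :
    Δ[H] ≫ (inv 𝒮[H] ⊗ₘ 𝟙 H) ≫ (β_ H H).inv ≫ μ[H] = ε[H] ≫ η[H] := by
  rw [← cancel_mono 𝒮[H]]
  simp only [Category.assoc, HopfObj.mul_antipode, HopfObj.one_antipode]
  rw [← BraidedCategory.braiding_inv_naturality_assoc, Iso.inv_hom_id_assoc,
    tensorHom_comp_tensorHom_assoc, IsIso.inv_hom_id, Category.id_comp, id_tensorHom,
    HopfObj.antipode_right]

theorem antipode_inv_right [HopfObj H] [IsIso 𝒮[H]] :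
    Δ[H] ≫ (𝟙 H ⊗ₘ inv 𝒮[H]) ≫ (β_ H H).inv ≫ μ[H] = ε[H] ≫ η[H] := by
  rw [← cancel_mono 𝒮[H]]
  simp only [Category.assoc, HopfObj.mul_antipode, HopfObj.one_antipode]
  rw [← BraidedCategory.braiding_inv_naturality_assoc, Iso.inv_hom_id_assoc,
    tensorHom_comp_tensorHom_assoc, IsIso.inv_hom_id, Category.id_comp, tensorHom_id,
    HopfObj.antipode_left]

/-- The Yetter-Drinfel'd braiding is invertible if the antipode is. -/
@[simps hom]
noncomputable def ydBraidIso [HopfObj H] [IsIso 𝒮[H]] {X Y : C} {a : X ⊗ H ⟶ X} {s : Y ⟶ Y ⊗ H}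
    (ha : IsAction a) (hs : IsCoaction s) : X ⊗ Y ≅ Y ⊗ X where
  hom := ydBraid a s
  inv := twist a s (inv 𝒮[H]) ≫ (β_ X Y).inv
  hom_inv_id := by
    rw [ydBraid_eq_twist, Category.assoc, ← Category.assoc (twist a s (𝟙 H)), twist_comp ha hs,
      antipode_inv_left, twist_one ha hs]
    simp
  inv_hom_id := by
    rw [ydBraid_eq_twist, Category.assoc, Iso.inv_hom_id_assoc, twist_comp ha hs,
      antipode_inv_right, twist_one ha hs]

end CoactionsTensor

section YetterDrinfeld
variable {C : Type u} [Category.{v} C] [MonoidalCategory C] [BraidedCategory C]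

/-- A right-right Yetter-Drinfel'd module over the bialgebra `H` (also called a crossed module):
an object with a right action and a right coaction which are compatible. -/
structure YD (H : C) [BimonObj H] where
  /-- the underlying object -/
  X : C
  /-- the right action -/
  act : X ⊗ H ⟶ X
  /-- the right coaction -/
  coact : X ⟶ X ⊗ H
  isAction : IsAction act
  isCoaction : IsCoaction coact
  isYD : IsYD act coact

namespace YD

section Category

variable {H : C} [BimonObj H]

/-- A morphism of Yetter-Drinfel'd modules: a linear and colinear morphism of `C`. -/
@[ext]
structure Hom (M N : YD H) where
  /-- the underlying morphism -/
  hom : M.X ⟶ N.X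
  linear : M.act ≫ hom = hom ▷ H ≫ N.act
  colinear : M.coact ≫ hom ▷ H = hom ≫ N.coact

instance : Category (YD H) where
  Hom M N := Hom M N
  id M := ⟨𝟙 M.X, by simp, by simp⟩
  comp f g := ⟨f.hom ≫ g.hom, by
    rw [← Category.assoc, f.linear, Category.assoc, g.linear, comp_whiskerRight, Category.assoc],
    by rw [comp_whiskerRight, ← Category.assoc, f.colinear, Category.assoc, g.colinear,
      Category.assoc]⟩

@[ext]
theorem hom_ext {M N : YD H} {f g : M ⟶ N} (h : f.hom = g.hom) : f = g := Hom.ext h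

@[simp] theorem id_hom (M : YD H) : Hom.hom (𝟙 M) = 𝟙 M.X := rfl

@[simp] theorem comp_hom {M N P : YD H} (f : M ⟶ N) (g : N ⟶ P) :
    (f ≫ g).hom = f.hom ≫ g.hom := rfl

/-- An isomorphism of `C` which is linear and colinear is an isomorphism of Yetter-Drinfel'd
modules. -/
@[simps] def mkIso {M N : YD H} (e : M.X ≅ N.X) (h : M.act ≫ e.hom = e.hom ▷ H ≫ N.act)
    (h' : M.coact ≫ e.hom ▷ H = e.hom ≫ N.coact) : M ≅ N where
  hom := ⟨e.hom, h, h'⟩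
  inv := ⟨e.inv, by
    rw [Iso.comp_inv_eq, Category.assoc, h, ← comp_whiskerRight_assoc, e.inv_hom_id,
      id_whiskerRight, Category.id_comp], by
    rw [Iso.eq_inv_comp, ← Category.assoc, ← h', Category.assoc, ← comp_whiskerRight,
      e.hom_inv_id, id_whiskerRight, Category.comp_id]⟩
  hom_inv_id := by ext; simp
  inv_hom_id := by ext; simp

/-- Yetter-Drinfel'd modules form a monoidal category, with the diagonal action and the
codiagonal coaction on tensor products, and the constraints of `C`. -/
instance : MonoidalCategory (YD H) where
  tensorObj M N := ⟨M.X ⊗ N.X, diagAct M.act N.act, diagCoact M.coact N.coact,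
    M.isAction.diag N.isAction, M.isCoaction.diag N.isCoaction,
    M.isYD.diag M.isAction N.isAction N.isYD⟩
  tensorUnit := ⟨𝟙_ C, unitAct H, unitCoact H, isAction_unitAct, isCoaction_unit, isYD_unit⟩
  tensorHom f g := ⟨f.hom ⊗ₘ g.hom, diagAct_natural f.linear g.linear,
    diagCoact_natural f.colinear g.colinear⟩
  whiskerLeft M _ _ f := ⟨M.X ◁ f.hom,
    by rw [← id_tensorHom]; exact diagAct_natural (Hom.linear (𝟙 M)) f.linear,
    by rw [← id_tensorHom M.X]; exact diagCoact_natural (Hom.colinear (𝟙 M)) f.colinear⟩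
  whiskerRight f M := ⟨f.hom ▷ M.X,
    by rw [← tensorHom_id]; exact diagAct_natural f.linear (Hom.linear (𝟙 M)),
    by rw [← tensorHom_id _ M.X]; exact diagCoact_natural f.colinear (Hom.colinear (𝟙 M))⟩
  associator M N P := mkIso (α_ M.X N.X P.X) (diagAct_associator M.act N.act P.act)
    (diagCoact_associator M.coact N.coact P.coact)
  leftUnitor M := mkIso (λ_ M.X) (diagAct_leftUnitor M.act) (diagCoact_leftUnitor M.coact)
  rightUnitor M := mkIso (ρ_ M.X) (diagAct_rightUnitor M.act) (diagCoact_rightUnitor M.coact)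
  tensorHom_def f g := by ext; exact MonoidalCategory.tensorHom_def _ _
  id_tensorHom_id _ _ := by ext; exact id_tensorHom_id _ _
  tensorHom_comp_tensorHom _ _ _ _ := by ext; exact tensorHom_comp_tensorHom _ _ _ _
  whiskerLeft_id _ _ := by ext; exact whiskerLeft_id _ _
  id_whiskerRight _ _ := by ext; exact id_whiskerRight _ _
  associator_naturality _ _ _ := by ext; exact associator_naturality _ _ _
  leftUnitor_naturality _ := by ext; exact leftUnitor_naturality _
  rightUnitor_naturality _ := by ext; exact rightUnitor_naturality _
  pentagon _ _ _ _ := by ext; exact pentagon _ _ _ _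
  triangle _ _ := by ext; exact triangle _ _

end Category

variable {H : C} [HopfObj H] [IsIso 𝒮[H]]

/-- Yetter-Drinfel'd modules over a Hopf algebra with invertible antipode form a braided
category, with the braiding `x ⊗ y ↦ y₍₀₎ ⊗ x y₍₁₎`. -/
noncomputable instance : BraidedCategory (YD H) where
  braiding M N := mkIso (ydBraidIso M.isAction N.isCoaction)
    (ydBraid_linear M.isAction N.isYD) (ydBraid_colinear N.isCoaction M.isYD).symm
  braiding_naturality_right M _ _ g := by
    ext; exact ydBraid_natural_right M.act g.colinear
  braiding_naturality_left f N := by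
    ext; exact ydBraid_natural_left f.linear N.coact
  hexagon_forward M N P := by
    ext; exact ydBraid_hexagon_forward M.isAction N.coact P.coact
  hexagon_reverse M N P := by
    ext; exact ydBraid_hexagon_reverse M.act N.act P.isCoaction

end YD
end YetterDrinfeld

section Points
variable {C : Type u} [Category.{v} C] [MonoidalCategory C]

/-- The product of two "elements" `f g : 𝟙_ C ⟶ A` of an algebra `A`. -/
def pmul {A : C} [MonObj A] (f g : 𝟙_ C ⟶ A) : 𝟙_ C ⟶ A :=
  (λ_ (𝟙_ C)).inv ≫ (f ⊗ₘ g) ≫ μ[A]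

theorem pmul_one {A : C} [MonObj A] (f : 𝟙_ C ⟶ A) : pmul f η[A] = f := by
  simp only [pmul, MonoidalCategory.tensorHom_def, Category.assoc, MonObj.mul_one]
  monoidal

theorem one_pmul {A : C} [MonObj A] (f : 𝟙_ C ⟶ A) : pmul η[A] f = f := by
  simp only [pmul, MonoidalCategory.tensorHom_def', Category.assoc, MonObj.one_mul]
  monoidal

theorem pmul_assoc {A : C} [MonObj A] (f g h : 𝟙_ C ⟶ A) :
    pmul (pmul f g) h = pmul f (pmul g h) := by
  simp only [pmul, MonoidalCategory.tensorHom_def]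
  calc
    _ = 𝟙 _ ⊗≫ f ⊗≫ A ◁ g ⊗≫ (μ[A] ▷ 𝟙_ C ≫ A ◁ h) ⊗≫ μ[A] := by monoidal
    _ = 𝟙 _ ⊗≫ f ⊗≫ A ◁ g ⊗≫ A ◁ A ◁ h ⊗≫ (μ[A] ▷ A ≫ μ[A]) := by
      rw [← whisker_exchange]; monoidal
    _ = _ := by rw [MonObj.mul_assoc]; monoidal

/-- The coaction `x ↦ x R¹ ⊗ R²` of `H` on an `H`-module. -/
def coactR {H : C} (R : 𝟙_ C ⟶ H ⊗ H) {X : C} (a : X ⊗ H ⟶ X) : X ⟶ X ⊗ H :=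
  (ρ_ X).inv ≫ X ◁ R ≫ (α_ X H H).inv ≫ a ▷ H

theorem coactR_natural {H : C} {R : 𝟙_ C ⟶ H ⊗ H} {X Y : C} {a : X ⊗ H ⟶ X} {b : Y ⊗ H ⟶ Y} {f : X ⟶ Y}
    (h : a ≫ f = f ▷ H ≫ b) : coactR R a ≫ f ▷ H = f ≫ coactR R b := by
  simp only [coactR, Category.assoc, ← comp_whiskerRight, h]
  calc
    _ = 𝟙 _ ⊗≫ (X ◁ R ≫ f ▷ (H ⊗ H)) ⊗≫ b ▷ H := by monoidal
    _ = _ := by rw [whisker_exchange]; monoidal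

end Points

section Quasitriangular
variable {C : Type u} [Category.{v} C] [MonoidalCategory C] [BraidedCategory C]

/-- A quasitriangular structure (universal R-matrix) `R = R¹ ⊗ R²` on a bialgebra `H`, with respect
to the opposite comultiplication `Δ ≫ (β_ H H).hom`. -/
class Quasitriangular (H : C) [BimonObj H] where
  /-- the R-matrix -/
  R : 𝟙_ C ⟶ H ⊗ H
  /-- the inverse of the R-matrix in the algebra `H ⊗ H` -/
  Rinv : 𝟙_ C ⟶ H ⊗ H
  R_Rinv : pmul R Rinv = η[H ⊗ H]
  Rinv_R : pmul Rinv R = η[H ⊗ H]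
  /-- `(Δ ⊗ id) R = R₁₃ R₂₃`, i.e. `Δ(R¹) ⊗ R² = R¹ ⊗ r¹ ⊗ R² r²`. -/
  comul_left : R ≫ Δ[H] ▷ H =
    (λ_ (𝟙_ C)).inv ≫ (R ⊗ₘ R) ≫ tensorμ H H H H ≫ (H ⊗ H) ◁ μ[H]
  /-- `(id ⊗ Δ) R = R₁₃ R₁₂`, i.e. `R¹ ⊗ Δ(R²) = R¹ r¹ ⊗ r² ⊗ R²`. -/
  comul_right : R ≫ H ◁ Δ[H] =
    (λ_ (𝟙_ C)).inv ≫ (R ⊗ₘ R) ≫ tensorμ H H H H ≫ (μ[H] ⊗ₘ (β_ H H).hom)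
  /-- `Δᵒᵖ(h) R = R Δ(h)`. -/
  comul_op : (ρ_ H).inv ≫ ((Δ[H] ≫ (β_ H H).hom) ⊗ₘ R) ≫ μ[H ⊗ H] =
    (λ_ H).inv ≫ (R ⊗ₘ Δ[H]) ≫ μ[H ⊗ H]

/-- The braiding between `H` and each right `H`-module of `C` is symmetric. -/
class SymmetricOnModules (H : C) [MonObj H] : Prop where
  symm : ∀ M : RMod H, (β_ H M.X).hom ≫ (β_ M.X H).hom = 𝟙 (H ⊗ M.X)

theorem symm_left {H : C} [MonObj H] [SymmetricOnModules H] {X : C} {a : X ⊗ H ⟶ X}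
    (ha : IsAction a) : (β_ H X).hom ≫ (β_ X H).hom = 𝟙 (H ⊗ X) :=
  SymmetricOnModules.symm ⟨X, a, ha⟩

theorem symm_right {H : C} [MonObj H] [SymmetricOnModules H] {X : C} {a : X ⊗ H ⟶ X}
    (ha : IsAction a) : (β_ X H).hom ≫ (β_ H X).hom = 𝟙 (X ⊗ H) := by
  rw [← cancel_epi (β_ H X).hom, reassoc_of% symm_left ha, Category.comp_id]

section

variable {H : C} {R : 𝟙_ C ⟶ H ⊗ H}

theorem R_pass (R : 𝟙_ C ⟶ H ⊗ H) (Z : C) :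
    Z ◁ R ≫ (α_ Z H H).inv ≫ (β_ Z H).hom ▷ H ≫ (α_ H Z H).hom ≫ H ◁ (β_ Z H).hom =
      (ρ_ Z).hom ≫ (λ_ Z).inv ≫ R ▷ Z ≫ (α_ H H Z).hom := by
  have := BraidedCategory.braiding_naturality_right Z R
  rw [BraidedCategory.braiding_tensor_right_hom, braiding_tensorUnit_right] at this
  rw [← cancel_mono (α_ H H Z).inv]
  simpa using this

variable [BimonObj H]

theorem R_counit {Rinv : 𝟙_ C ⟶ H ⊗ H} (hR : pmul R Rinv = η[H ⊗ H])
    (h : R ≫ H ◁ Δ[H] =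
      (λ_ (𝟙_ C)).inv ≫ (R ⊗ₘ R) ≫ tensorμ H H H H ≫ (μ[H] ⊗ₘ (β_ H H).hom)) :
    R ≫ H ◁ ε[H] ≫ (ρ_ H).hom = η[H] := by
  let e : 𝟙_ C ⟶ H := R ≫ H ◁ ε[H] ≫ (ρ_ H).hom
  let e' : 𝟙_ C ⟶ H ⊗ H := (λ_ (𝟙_ C)).inv ≫ (e ⊗ₘ η[H])
  have h1 : pmul e' R = R := by
    have : R ≫ H ◁ Δ[H] ≫ H ◁ H ◁ ε[H] ≫ H ◁ (ρ_ H).hom =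
        (λ_ (𝟙_ C)).inv ≫ (R ⊗ₘ R) ≫ tensorμ H H H H ≫ (μ[H] ⊗ₘ (β_ H H).hom) ≫ H ◁ H ◁ ε[H] ≫
          H ◁ (ρ_ H).hom := by
      rw [reassoc_of% h]
    rw [← whiskerLeft_comp_assoc, ComonObj.comul_counit, ← whiskerLeft_comp, Iso.inv_hom_id,
      whiskerLeft_id, Category.comp_id] at this
    conv_rhs => rw [this]
    simp only [pmul, e', e, MonObj.tensorObj.mul_def, tensorμ, MonoidalCategory.tensorHom_def]
    calc
      _ = 𝟙 _ ⊗≫ R ⊗≫ H ◁ ε[H] ⊗≫ H ◁ η[H] ⊗≫ (H ⊗ H) ◁ R ⊗≫ H ◁ (β_ H H).hom ▷ H ⊗≫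
            μ[H] ▷ (H ⊗ H) ⊗≫ H ◁ μ[H] := by monoidal
      _ = 𝟙 _ ⊗≫ R ⊗≫ H ◁ ε[H] ⊗≫ H ◁ (η[H] ▷ 𝟙_ C ≫ H ◁ R) ⊗≫ H ◁ (β_ H H).hom ▷ H ⊗≫
            μ[H] ▷ (H ⊗ H) ⊗≫ H ◁ μ[H] := by monoidal
      _ = 𝟙 _ ⊗≫ R ⊗≫ H ◁ ε[H] ⊗≫ H ◁ R ⊗≫ H ◁ (η[H] ▷ H ≫ (β_ H H).hom) ▷ H ⊗≫
            (μ[H] ▷ (H ⊗ H) ≫ H ◁ μ[H]) := by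
          rw [← whisker_exchange]; monoidal
      _ = 𝟙 _ ⊗≫ R ⊗≫ H ◁ (ε[H] ▷ 𝟙_ C ≫ 𝟙_ C ◁ R) ⊗≫ H ◁ H ◁ (η[H] ▷ H ≫ μ[H]) ⊗≫
            μ[H] ▷ H := by
          rw [← whisker_exchange, BraidedCategory.braiding_naturality_left,
            braiding_tensorUnit_left]
          monoidal
      _ = 𝟙 _ ⊗≫ R ⊗≫ H ◁ H ◁ R ⊗≫ H ◁ (ε[H] ▷ H ⊗≫ 𝟙 H) ▷ H ⊗≫ μ[H] ▷ H := by
          rw [← whisker_exchange, MonObj.one_mul]; monoidal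
      _ = 𝟙 _ ⊗≫ R ⊗≫ H ◁ H ◁ R ⊗≫ H ◁ ((β_ H H).hom ≫ H ◁ ε[H]) ▷ H ⊗≫ μ[H] ▷ H ⊗≫ 𝟙 _ := by
          rw [← BraidedCategory.braiding_naturality_left, braiding_tensorUnit_left]; monoidal
      _ = 𝟙 _ ⊗≫ R ⊗≫ H ◁ H ◁ R ⊗≫ H ◁ (β_ H H).hom ▷ H ⊗≫ (H ⊗ H) ◁ (ε[H] ▷ H ≫
            (β_ (𝟙_ C) H).hom) ⊗≫ μ[H] ▷ H ⊗≫ 𝟙 _ := by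
          rw [braiding_tensorUnit_left]; monoidal
      _ = 𝟙 _ ⊗≫ R ⊗≫ H ◁ H ◁ R ⊗≫ H ◁ (β_ H H).hom ▷ H ⊗≫
            ((H ⊗ H) ◁ ((β_ H H).hom ≫ H ◁ ε[H]) ≫ μ[H] ▷ (H ⊗ 𝟙_ C)) ⊗≫ 𝟙 _ := by
          rw [BraidedCategory.braiding_naturality_left]; monoidal
      _ = _ := by
          rw [whisker_exchange]; monoidal
  have h2 : e' = η[H ⊗ H] := by
    rw [← pmul_one e', ← hR, ← pmul_assoc, h1]
  have h3 : e' ≫ H ◁ ε[H] ≫ (ρ_ H).hom = e := by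
    simp only [e', MonoidalCategory.tensorHom_def, Category.assoc]
    rw [← whiskerLeft_comp_assoc, BimonObj.one_counit]; monoidal
  change e = _
  rw [← h3, h2, MonObj.tensorObj.one_def, MonoidalCategory.tensorHom_def, Category.assoc,
    Category.assoc, ← whiskerLeft_comp_assoc, BimonObj.one_counit]
  monoidal

theorem isCoaction_coactR {Rinv : 𝟙_ C ⟶ H ⊗ H} (hR : pmul R Rinv = η[H ⊗ H])
    (h : R ≫ H ◁ Δ[H] =
      (λ_ (𝟙_ C)).inv ≫ (R ⊗ₘ R) ≫ tensorμ H H H H ≫ (μ[H] ⊗ₘ (β_ H H).hom))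
    {X : C} {a : X ⊗ H ⟶ X} (ha : IsAction a) : IsCoaction (coactR R a) where
  counit := by
    simp only [coactR, Category.assoc]
    rw [← whisker_exchange]
    calc
      _ = 𝟙 _ ⊗≫ X ◁ (R ≫ H ◁ ε[H] ≫ (ρ_ H).hom) ⊗≫ a ⊗≫ 𝟙 _ := by monoidal
      _ = 𝟙 _ ⊗≫ (X ◁ η[H] ≫ a) ⊗≫ 𝟙 _ := by rw [R_counit hR h]; monoidal
      _ = _ := by rw [ha.one]; monoidal
  comul := by
    simp only [coactR]
    symm
    calc
      _ = 𝟙 _ ⊗≫ X ◁ R ⊗≫ (a ▷ (𝟙_ C ⊗ H) ≫ X ◁ (R ▷ H)) ⊗≫ a ▷ H ▷ H ⊗≫ 𝟙 _ := by monoidal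
      _ = 𝟙 _ ⊗≫ X ◁ R ⊗≫ (X ⊗ H) ◁ R ▷ H ⊗≫ ((α_ X H H).inv ≫ a ▷ H ≫ a) ▷ H ▷ H ⊗≫ 𝟙 _ := by
        rw [← whisker_exchange]; monoidal
      _ = 𝟙 _ ⊗≫ X ◁ R ⊗≫ (X ⊗ H) ◁ ((ρ_ H).hom ≫ (λ_ H).inv ≫ R ▷ H ≫ (α_ H H H).hom) ⊗≫
            X ◁ μ[H] ▷ H ▷ H ⊗≫ a ▷ H ▷ H ⊗≫ 𝟙 _ := by
        rw [← ha.mul]; monoidal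
      _ = 𝟙 _ ⊗≫ X ◁ R ⊗≫ (X ⊗ H) ◁ H ◁ R ⊗≫ (X ⊗ H) ◁ (β_ H H).hom ▷ H ⊗≫
            X ◁ ((H ⊗ H) ◁ (β_ H H).hom ≫ μ[H] ▷ (H ⊗ H)) ⊗≫ a ▷ H ▷ H ⊗≫ 𝟙 _ := by
        rw [← R_pass]; monoidal
      _ = 𝟙 _ ⊗≫ X ◁ ((λ_ (𝟙_ C)).inv ≫ (R ⊗ₘ R) ≫ tensorμ H H H H ≫ (μ[H] ⊗ₘ (β_ H H).hom)) ⊗≫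
           a ▷ H ▷ H ⊗≫ 𝟙 _ := by
        rw [whisker_exchange]
        simp only [tensorμ, MonoidalCategory.tensorHom_def]
        monoidal
      _ = 𝟙 _ ⊗≫ X ◁ R ⊗≫ ((X ⊗ H) ◁ Δ[H] ≫ a ▷ (H ⊗ H)) ⊗≫ 𝟙 _ := by
        rw [← h]; monoidal
      _ = _ := by
        rw [whisker_exchange]; monoidal

theorem isYD_coactR (h : (ρ_ H).inv ≫ ((Δ[H] ≫ (β_ H H).hom) ⊗ₘ R) ≫ μ[H ⊗ H] =
    (λ_ H).inv ≫ (R ⊗ₘ Δ[H]) ≫ μ[H ⊗ H])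
    {X : C} {a : X ⊗ H ⟶ X} (ha : IsAction a)
    (hs : (β_ X H).hom ≫ (β_ H X).hom = 𝟙 (X ⊗ H)) : IsYD a (coactR R a) := by
  have h : 𝟙 _ ⊗≫ X ◁ ((ρ_ H).inv ≫ ((Δ[H] ≫ (β_ H H).hom) ⊗ₘ R) ≫ μ[H ⊗ H]) ⊗≫ a ▷ H ⊗≫ 𝟙 _ =
    𝟙 (X ⊗ H) ⊗≫ X ◁ ((λ_ H).inv ≫ (R ⊗ₘ Δ[H]) ≫ μ[H ⊗ H]) ⊗≫ a ▷ H ⊗≫ 𝟙 (X ⊗ H) := by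
    rw [h]
  simp only [MonObj.tensorObj.mul_def, tensorμ] at h
  simp only [IsYD, coactR, tensorμ, MonoidalCategory.tensorHom_def]
  refine Eq.trans ?_ (h.trans ?_)
  · simp only [MonoidalCategory.tensorHom_def]
    calc
      _ = 𝟙 _ ⊗≫ X ◁ Δ[H] ⊗≫ (β_ X H).hom ▷ H ⊗≫ H ◁ (a ▷ 𝟙_ C ≫ X ◁ R) ⊗≫
          (H ◁ a ≫ (β_ H X).hom) ▷ H ⊗≫ X ◁ μ[H] := by monoidal
      _ = 𝟙 _ ⊗≫ X ◁ Δ[H] ⊗≫ (β_ X H).hom ▷ H ⊗≫ H ◁ (X ⊗ H) ◁ R ⊗≫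
          (H ◁ ((α_ X H H).inv ≫ a ▷ H ≫ a) ≫ (β_ H X).hom) ▷ H ⊗≫ X ◁ μ[H] := by
        rw [← whisker_exchange]; monoidal
      _ = 𝟙 _ ⊗≫ X ◁ Δ[H] ⊗≫ (β_ X H).hom ▷ H ⊗≫ H ◁ (X ⊗ H) ◁ R ⊗≫
          ((H ◁ (X ◁ μ[H] ≫ a)) ≫ (β_ H X).hom) ▷ H ⊗≫ X ◁ μ[H] := by
        rw [ha.mul]
      _ = 𝟙 _ ⊗≫ X ◁ Δ[H] ⊗≫ ((β_ X H).hom ▷ (H ⊗ 𝟙_ C) ≫ (H ⊗ X) ◁ H ◁ R) ⊗≫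
          (β_ H X).hom ▷ ((H ⊗ H) ⊗ H) ⊗≫ X ◁ (β_ H H).hom ▷ H ▷ H ⊗≫
          X ◁ H ◁ (β_ H H).hom ▷ H ⊗≫ X ◁ μ[H] ▷ (H ⊗ H) ⊗≫ (a ▷ (H ⊗ H) ≫ X ◁ μ[H]) := by
        rw [BraidedCategory.braiding_naturality_right,
          BraidedCategory.braiding_tensor_right_hom, BraidedCategory.braiding_tensor_right_hom]
        monoidal
      _ = 𝟙 _ ⊗≫ X ◁ Δ[H] ⊗≫ ((X ⊗ H) ◁ H ◁ R) ⊗≫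
          ((β_ X H).hom ≫ (β_ H X).hom) ▷ ((H ⊗ H) ⊗ H) ⊗≫ X ◁ (β_ H H).hom ▷ H ▷ H ⊗≫
          X ◁ H ◁ (β_ H H).hom ▷ H ⊗≫ X ◁ μ[H] ▷ (H ⊗ H) ⊗≫ (X ⊗ H) ◁ μ[H] ⊗≫ a ▷ H := by
        rw [← whisker_exchange, ← whisker_exchange]; monoidal
      _ = 𝟙 _ ⊗≫ X ◁ Δ[H] ⊗≫ X ◁ ((H ⊗ H) ◁ R ≫ (β_ H H).hom ▷ (H ⊗ H)) ⊗≫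
          X ◁ H ◁ (β_ H H).hom ▷ H ⊗≫ X ◁ μ[H] ▷ (H ⊗ H) ⊗≫ (X ⊗ H) ◁ μ[H] ⊗≫ a ▷ H := by
        rw [hs]; monoidal
      _ = _ := by
        rw [whisker_exchange]; monoidal
  · simp only [MonoidalCategory.tensorHom_def']
    calc
      _ = 𝟙 _ ⊗≫ X ◁ (𝟙_ C ◁ Δ[H] ≫ R ▷ (H ⊗ H)) ⊗≫ X ◁ H ◁ (β_ H H).hom ▷ H ⊗≫
            X ◁ (H ⊗ H) ◁ μ[H] ⊗≫ (X ◁ μ[H] ≫ a) ▷ H ⊗≫ 𝟙 _ := by monoidal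
      _ = 𝟙 _ ⊗≫ X ◁ R ▷ H ⊗≫ X ◁ H ◁ H ◁ Δ[H] ⊗≫ X ◁ H ◁ (β_ H H).hom ▷ H ⊗≫
            ((X ⊗ H ⊗ H) ◁ μ[H] ≫ ((α_ X H H).inv ≫ a ▷ H ≫ a) ▷ H) ⊗≫ 𝟙 _ := by
        rw [whisker_exchange, ha.mul]; monoidal
      _ = 𝟙 _ ⊗≫ X ◁ R ▷ H ⊗≫ X ◁ H ◁ H ◁ Δ[H] ⊗≫ ((X ⊗ H) ◁ (β_ H H).hom ▷ H ≫
            a ▷ ((H ⊗ H) ⊗ H)) ⊗≫ a ▷ (H ⊗ H) ⊗≫ X ◁ μ[H] ⊗≫ 𝟙 _ := by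
        rw [whisker_exchange]; monoidal
      _ = 𝟙 _ ⊗≫ X ◁ R ▷ H ⊗≫ ((X ⊗ H) ◁ H ◁ Δ[H] ≫ a ▷ (H ⊗ H ⊗ H)) ⊗≫ X ◁ (β_ H H).hom ▷ H ⊗≫
            a ▷ (H ⊗ H) ⊗≫ X ◁ μ[H] ⊗≫ 𝟙 _ := by
        rw [whisker_exchange]; monoidal
      _ = _ := by
        rw [whisker_exchange]
        monoidal

theorem coactR_diag (h : R ≫ Δ[H] ▷ H =
      (λ_ (𝟙_ C)).inv ≫ (R ⊗ₘ R) ≫ tensorμ H H H H ≫ (H ⊗ H) ◁ μ[H])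
    {X Y : C} (a : X ⊗ H ⟶ X) (b : Y ⊗ H ⟶ Y)
    (hs : (β_ Y H).hom ≫ (β_ H Y).hom = 𝟙 (Y ⊗ H)) :
    coactR R (diagAct a b) = diagCoact (coactR R a) (coactR R b) := by
  simp only [diagCoact, coactR, diagAct]
  calc
    _ = 𝟙 _ ⊗≫ (X ⊗ Y) ◁ (R ≫ Δ[H] ▷ H) ⊗≫ (tensorμ X Y H H ≫ (a ⊗ₘ b)) ▷ H := by monoidal
    _ = 𝟙 _ ⊗≫ (X ⊗ Y) ◁ R ⊗≫ (X ⊗ Y) ◁ (H ⊗ H) ◁ R ⊗≫ (X ⊗ Y) ◁ H ◁ (β_ H H).hom ▷ H ⊗≫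
          (((X ⊗ Y) ⊗ H ⊗ H) ◁ μ[H] ≫ (tensorμ X Y H H ≫ (a ⊗ₘ b)) ▷ H) := by
      rw [h]
      simp only [tensorμ, MonoidalCategory.tensorHom_def R R]
      monoidal
    _ = 𝟙 _ ⊗≫ (X ⊗ Y) ◁ R ⊗≫ (X ◁ Y ◁ H ◁ (H ◁ R ≫ (α_ H H H).inv ≫ (β_ H H).hom ▷ H)) ⊗≫
          X ◁ (β_ Y H).hom ▷ H ▷ H ▷ H ⊗≫ a ▷ Y ▷ H ▷ H ▷ H ⊗≫ X ◁ b ▷ (H ⊗ H) ⊗≫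
          X ◁ Y ◁ μ[H] ⊗≫ 𝟙 _ := by
      rw [whisker_exchange]
      simp only [tensorμ, MonoidalCategory.tensorHom_def a b]
      monoidal
    _ = 𝟙 _ ⊗≫ X ◁ Y ◁ R ⊗≫ X ◁ ((Y ⊗ H) ◁ (H ◁ R ≫ (α_ H H H).inv ≫ (β_ H H).hom ▷ H) ≫
          (β_ Y H).hom ▷ ((H ⊗ H) ⊗ H)) ⊗≫ a ▷ Y ▷ H ▷ H ▷ H ⊗≫ X ◁ b ▷ (H ⊗ H) ⊗≫
          X ◁ Y ◁ μ[H] ⊗≫ 𝟙 _ := by monoidal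
    _ = 𝟙 _ ⊗≫ X ◁ Y ◁ R ⊗≫ X ◁ (β_ Y H).hom ▷ H ⊗≫
          ((X ⊗ H) ◁ (Y ◁ (H ◁ R ≫ (α_ H H H).inv ≫ (β_ H H).hom ▷ H)) ≫
          a ▷ (Y ⊗ (H ⊗ H) ⊗ H)) ⊗≫ X ◁ b ▷ (H ⊗ H) ⊗≫ X ◁ Y ◁ μ[H] ⊗≫ 𝟙 _ := by
      rw [whisker_exchange]; monoidal
    _ = 𝟙 _ ⊗≫ X ◁ Y ◁ R ⊗≫ X ◁ (β_ Y H).hom ▷ H ⊗≫ (X ⊗ H) ◁ 𝟙 (Y ⊗ H) ⊗≫ a ▷ (Y ⊗ H) ⊗≫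
          X ◁ Y ◁ H ◁ R ⊗≫ X ◁ Y ◁ (β_ H H).hom ▷ H ⊗≫ X ◁ b ▷ (H ⊗ H) ⊗≫ X ◁ Y ◁ μ[H] ⊗≫
          𝟙 _ := by
      rw [whisker_exchange]; monoidal
    _ = 𝟙 _ ⊗≫ X ◁ (Y ◁ R ≫ (α_ Y H H).inv ≫ (β_ Y H).hom ▷ H ≫ (α_ H Y H).hom ≫
          H ◁ (β_ Y H).hom) ⊗≫ ((X ⊗ H) ◁ (β_ H Y).hom ≫ a ▷ (Y ⊗ H)) ⊗≫
          X ◁ Y ◁ H ◁ R ⊗≫ X ◁ Y ◁ (β_ H H).hom ▷ H ⊗≫ X ◁ b ▷ (H ⊗ H) ⊗≫ X ◁ Y ◁ μ[H] ⊗≫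
          𝟙 _ := by
      rw [← hs]; monoidal
    _ = 𝟙 _ ⊗≫ X ◁ R ▷ Y ⊗≫ a ▷ H ▷ Y ⊗≫ X ◁ ((β_ H Y).hom ▷ 𝟙_ C ≫ (Y ⊗ H) ◁ R) ⊗≫
          X ◁ Y ◁ (β_ H H).hom ▷ H ⊗≫ X ◁ b ▷ (H ⊗ H) ⊗≫ X ◁ Y ◁ μ[H] ⊗≫ 𝟙 _ := by
      rw [R_pass, whisker_exchange]; monoidal
    _ = 𝟙 _ ⊗≫ X ◁ R ▷ Y ⊗≫ a ▷ H ▷ Y ⊗≫ X ◁ H ◁ Y ◁ R ⊗≫ X ◁ ((β_ H (Y ⊗ H)).hom ≫ b ▷ H) ▷ H ⊗≫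
          X ◁ Y ◁ μ[H] ⊗≫ 𝟙 _ := by
      rw [← whisker_exchange, BraidedCategory.braiding_tensor_right_hom]; monoidal
    _ = _ := by
      rw [← BraidedCategory.braiding_naturality_right]
      simp only [tensorμ, MonoidalCategory.tensorHom_def]
      monoidal

end
end Quasitriangular

section Bosonization
variable {C : Type u} [Category.{v} C] [MonoidalCategory C] [BraidedCategory C]

/-- Modules over a quasitriangular Hopf algebra form a braided category, with the braiding
`x ⊗ y ↦ y R¹ ⊗ x R²`, see `RMod.braiding_hom`. -/
noncomputable instance {H : C} [HopfObj H] [IsIso 𝒮[H]] [Quasitriangular H]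
    [SymmetricOnModules H] : BraidedCategory (RMod H) where
  braiding M N := RMod.mkIso
    (ydBraidIso M.isAction (isCoaction_coactR Quasitriangular.R_Rinv Quasitriangular.comul_right
      N.isAction))
    (ydBraid_linear M.isAction (isYD_coactR Quasitriangular.comul_op N.isAction
      (symm_right N.isAction)))
  braiding_naturality_right M _ _ g := by
    ext; exact ydBraid_natural_right M.act (coactR_natural g.linear)
  braiding_naturality_left f N := by
    ext; exact ydBraid_natural_left f.linear (coactR _ N.act)
  hexagon_forward M N P := by
    ext
    have := ydBraid_hexagon_forward M.isAction (coactR Quasitriangular.R N.act)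
      (coactR Quasitriangular.R P.act)
    rw [← coactR_diag Quasitriangular.comul_left _ _ (symm_right P.isAction)] at this
    exact this
  hexagon_reverse M N P := by
    ext
    exact ydBraid_hexagon_reverse M.act N.act (isCoaction_coactR Quasitriangular.R_Rinv
      Quasitriangular.comul_right P.isAction)

theorem ydBraid_coactR {H X Y : C} (R : 𝟙_ C ⟶ H ⊗ H) (a : X ⊗ H ⟶ X) (b : Y ⊗ H ⟶ Y) :
    ydBraid a (coactR R b) =
      (β_ X Y).hom ≫ (ρ_ (Y ⊗ X)).inv ≫ (Y ⊗ X) ◁ R ≫ extAct b a := by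
  simp only [ydBraid, coactR, extAct, tensorμ, MonoidalCategory.tensorHom_def]
  calc
    _ = 𝟙 _ ⊗≫ X ◁ Y ◁ R ⊗≫ (X ◁ b ≫ (β_ X Y).hom) ▷ H ⊗≫ Y ◁ a ⊗≫ 𝟙 _ := by monoidal
    _ = 𝟙 _ ⊗≫ ((X ⊗ Y) ◁ R ≫ (β_ X Y).hom ▷ (H ⊗ H)) ⊗≫ Y ◁ (β_ X H).hom ▷ H ⊗≫ b ▷ X ▷ H ⊗≫
          Y ◁ a ⊗≫ 𝟙 _ := by
      rw [BraidedCategory.braiding_naturality_right, BraidedCategory.braiding_tensor_right_hom]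
      monoidal
    _ = _ := by rw [whisker_exchange]; monoidal

/-- The braiding of modules is the braiding of `C` followed by the action of `R`. -/
theorem RMod.braiding_hom {H : C} [HopfObj H] [IsIso 𝒮[H]] [Quasitriangular H]
    [SymmetricOnModules H] (M N : RMod H) :
    (β_ M N).hom.hom = (β_ M.X N.X).hom ≫ (ρ_ (N.X ⊗ M.X)).inv ≫
      (N.X ⊗ M.X) ◁ Quasitriangular.R ≫ extAct N.act M.act := by
  change ydBraid M.act (coactR Quasitriangular.R N.act) = _
  exact ydBraid_coactR _ _ _

/-- A module over a quasitriangular bialgebra, with the coaction `x ↦ x R¹ ⊗ R²`, is a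
Yetter-Drinfel'd module. -/
def YD.ofRMod {H : C} [BimonObj H] [Quasitriangular H] [SymmetricOnModules H] (M : RMod H) :
    YD H where
  X := M.X
  act := M.act
  coact := coactR Quasitriangular.R M.act
  isAction := M.isAction
  isCoaction := isCoaction_coactR Quasitriangular.R_Rinv Quasitriangular.comul_right M.isAction
  isYD := isYD_coactR Quasitriangular.comul_op M.isAction (symm_right M.isAction)

variable {H B : C}

/-- The multiplication `(h ⊗ b)(h' ⊗ b') = h h'₍₁₎ ⊗ (b h'₍₂₎) b'` of the cross product
`H ⋉ B`, where `a` is the action of `H` on `B` and `m` the multiplication of `B`. -/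
def crossMul [BimonObj H] (a : B ⊗ H ⟶ B) (m : B ⊗ B ⟶ B) : (H ⊗ B) ⊗ (H ⊗ B) ⟶ H ⊗ B :=
  (α_ H B (H ⊗ B)).hom ≫
    H ◁ ((α_ B H B).inv ≫ ydBraid a Δ[H] ▷ B ≫ (α_ H B B).hom) ≫
    (α_ H H (B ⊗ B)).inv ≫ (μ[H] ⊗ₘ m)

/-- The comultiplication `h ⊗ b ↦ (h₍₁₎ ⊗ b₍₁₎₍₀₎) ⊗ (h₍₂₎ b₍₁₎₍₁₎ ⊗ b₍₂₎)` of the cross product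
`H ⋉ B`, where `r` is the coaction of `H` on `B` and `d` the comultiplication of `B`. -/
def crossComul [BimonObj H] (r : B ⟶ B ⊗ H) (d : B ⟶ B ⊗ B) : H ⊗ B ⟶ (H ⊗ B) ⊗ (H ⊗ B) :=
  (Δ[H] ⊗ₘ d) ≫ (α_ H H (B ⊗ B)).hom ≫
    H ◁ ((α_ H B B).inv ≫ ydBraid μ[H] r ▷ B ≫ (α_ B H B).hom) ≫
    (α_ H B (H ⊗ B)).inv

/-- The antipode of the cross product `H ⋉ B`: the Yetter-Drinfel'd braiding `H ⊗ B ⟶ B ⊗ H`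
(`H` with its regular action), followed by the antipodes, followed by the Yetter-Drinfel'd
braiding `B ⊗ H ⟶ H ⊗ B` (`H` with its regular coaction). -/
def crossAntipode [HopfObj H] (a : B ⊗ H ⟶ B) (r : B ⟶ B ⊗ H) (s : B ⟶ B) : H ⊗ B ⟶ H ⊗ B :=
  ydBraid μ[H] r ≫ (s ⊗ₘ 𝒮[H]) ≫ ydBraid a Δ[H]

end Bosonization

end BraidedHopf

open BraidedHopf

/-!
The proof reduces the axioms to properties of the two Yetter-Drinfel'd braidings
`B ⊗ H ⟶ H ⊗ B`, `b ⊗ h ↦ h₍₁₎ ⊗ b h₍₂₎`, and `H ⊗ B ⟶ B ⊗ H`, `h ⊗ b ↦ b₍₀₎ ⊗ h b₍₁₎`.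

A module `M` over the quasitriangular Hopf algebra `H` becomes a Yetter-Drinfel'd module with the
coaction `x ↦ x R¹ ⊗ R²`. This coaction is natural in linear morphisms, is codiagonal on tensor
products (`coactR_diag`) and trivial on the unit object (`coactR_unitAct`, which rests on
`ε(R¹) R² = 1`, see `counit_R`). So the structure morphisms of `B` are colinear, and since the
braidings agree, the Hopf algebra axioms carry over (`YD.hopfObjOfRMod`).

A `B`-module in the category of `H`-modules is an object `X` of `C` with actions of `H` and `B`, the
second one `H`-linear. Put `x (h ⊗ b) = (x h) b` (`crossAct`). Linearity gives
`x (y z) = (x y) z` for `y`, `z` in `H ⋉ B` (`crossAct_mul`). Applied to the free `B`-module on the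
regular `H`-module, whose underlying object is `H ⊗ B`, this is the associativity of `H ⋉ B`.

The action of `H ⋉ B` on a tensor product of `B`-modules is given by its comultiplication
(`crossAct_tensor`). This does two things at once. It shows that the passage from `B`-modules to
`H ⋉ B`-modules is strict monoidal. And it shows that the comultiplication is multiplicative: acting
on the tensor square of the regular module, `H ⋉ B` multiplies from the right by `Δ(x)`, and a
morphism `d` of algebras is recovered from such an action as the orbit `x ↦ 1 d(x)` of the unit
(`isMonHom_of_isAction`). The same argument for the unit object shows that the counit is
multiplicative.

Coassociativity and the two antipode equations follow from the compatibility of the braidings with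
the (co)multiplications of `H` and `B`, which holds by naturality and the hexagons (`mul_ydBraid`,
`ydBraid_mul`, `comul_ydBraid`, `ydBraid_comul`). Finally, an action of `H ⋉ B` restricts to actions
of `H` and `B` along `h ↦ h ⊗ 1` and `b ↦ 1 ⊗ b`, and as every `h ⊗ b` is `(h ⊗ 1) (1 ⊗ b)`, this is
inverse to the construction of `crossAct`.
-/

namespace BraidedHopf

/-! ### The counit and the R-matrix -/

section CounitR
variable {C : Type u} [Category.{v} C] [MonoidalCategory C]

theorem pmul_comp {A A' : C} [MonObj A] [MonObj A'] (x y : 𝟙_ C ⟶ A) (f : A ⟶ A') [IsMonHom f] :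
    pmul x y ≫ f = pmul (x ≫ f) (y ≫ f) := by
  simp only [pmul, Category.assoc, IsMonHom.mul_hom, tensorHom_comp_tensorHom_assoc]

variable [BraidedCategory C] {H : C} [BimonObj H]

/-- The other half of `R_counit`: `ε(R¹) R² = 1`. The left-hand side is idempotent by the hexagon
for `(Δ ⊗ id) R`, and invertible because `ε ⊗ id` is a morphism of algebras. -/
theorem counit_R {R Rinv : 𝟙_ C ⟶ H ⊗ H} (hR : pmul R Rinv = η[H ⊗ H])
    (h : R ≫ Δ[H] ▷ H =
      (λ_ (𝟙_ C)).inv ≫ (R ⊗ₘ R) ≫ tensorμ H H H H ≫ (H ⊗ H) ◁ μ[H]) :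
    R ≫ ε[H] ▷ H ≫ (λ_ H).hom = η[H] := by
  let f : H ⊗ H ⟶ H := (ε[H] ⊗ₘ 𝟙 H) ≫ (λ_ H).hom
  have hf : R ≫ ε[H] ▷ H ≫ (λ_ H).hom = R ≫ f := by simp [f]
  have idem : pmul (R ≫ f) (R ≫ f) = R ≫ f := by
    have h' := congrArg (· ≫ (ε[H] ⊗ₘ ε[H]) ▷ H ≫ (λ_ (𝟙_ C)).hom ▷ H ≫ (λ_ H).hom) h
    simp only [Category.assoc] at h'
    have e : Δ[H] ▷ H ≫ (ε[H] ⊗ₘ ε[H]) ▷ H ≫ (λ_ (𝟙_ C)).hom ▷ H ≫ (λ_ H).hom = f := by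
      simp only [f, ← comp_whiskerRight_assoc, MonoidalCategory.tensorHom_def, Category.assoc,
        ComonObj.counit_comul_assoc]
      monoidal
    rw [e] at h'
    refine Eq.trans ?_ h'.symm
    have e' : tensorμ H H H H ≫ (ε[H] ⊗ₘ ε[H]) ▷ (H ⊗ H) =
        (ε[H] ▷ H ⊗ₘ ε[H] ▷ H) ≫ tensorμ (𝟙_ C) H (𝟙_ C) H := by
      rw [← tensorHom_id, ← id_tensorHom_id, ← tensorμ_natural, tensorHom_id]
    rw [whisker_exchange_assoc, reassoc_of% e', pmul, ← tensorHom_comp_tensorHom]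
    simp only [f, tensorμ, braiding_tensorUnit_right, tensorHom_id, ← tensorHom_comp_tensorHom,
      Category.assoc]
    monoidal
  have : IsMonHom ε[H] := ⟨BimonObj.one_counit H, BimonObj.mul_counit H⟩
  have : IsMonHom f := inferInstanceAs (IsMonHom ((ε[H] ⊗ₘ 𝟙 H) ≫ (λ_ H).hom))
  have inv : pmul (R ≫ f) (Rinv ≫ f) = η[H] := by
    rw [← pmul_comp, hR, IsMonHom.one_hom]
  rw [hf, ← pmul_one (R ≫ f), ← inv, ← pmul_assoc, idem]

theorem coactR_unitAct {R Rinv : 𝟙_ C ⟶ H ⊗ H} (hR : pmul R Rinv = η[H ⊗ H])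
    (h : R ≫ Δ[H] ▷ H =
      (λ_ (𝟙_ C)).inv ≫ (R ⊗ₘ R) ≫ tensorμ H H H H ≫ (H ⊗ H) ◁ μ[H]) :
    coactR R (unitAct H) = unitCoact H := by
  simp only [coactR, unitAct, unitCoact, ← counit_R hR h]
  monoidal

end CounitR

/-! ### Hopf algebras of modules as Hopf algebras of Yetter-Drinfel'd modules -/

section YetterDrinfeldHopf
variable {C : Type u} [Category.{v} C] [MonoidalCategory C] [BraidedCategory C]
  {H : C}

theorem coact_ofRMod_tensor [BimonObj H] [Quasitriangular H]
    [SymmetricOnModules H] (M N : RMod H) :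
    (YD.ofRMod M ⊗ YD.ofRMod N).coact = (YD.ofRMod (M ⊗ N)).coact :=
  (coactR_diag Quasitriangular.comul_left M.act N.act (symm_right N.isAction)).symm

theorem coact_unit [BimonObj H] [Quasitriangular H] [SymmetricOnModules H] :
    (𝟙_ (YD H)).coact = (YD.ofRMod (𝟙_ (RMod H))).coact :=
  (coactR_unitAct Quasitriangular.R_Rinv Quasitriangular.comul_left).symm

/-- A Hopf algebra in the category of modules over a quasitriangular Hopf algebra is a Hopf algebra
in the category of Yetter-Drinfel'd modules, with the same structure morphisms. They are colinear
since the coaction `x ↦ x R¹ ⊗ R²` is natural and monoidal, and the axioms are the same equations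
in `C` since the braidings of the two categories agree. -/
@[reducible]
noncomputable def YD.hopfObjOfRMod [HopfObj H] [IsIso 𝒮[H]] [Quasitriangular H]
    [SymmetricOnModules H] (B : RMod H) [HopfObj B] : HopfObj (YD.ofRMod B) where
  one := ⟨η[B].hom, η[B].linear, by
    rw [coact_unit]; exact coactR_natural η[B].linear⟩
  mul := ⟨μ[B].hom, μ[B].linear, by
    rw [coact_ofRMod_tensor]; exact coactR_natural μ[B].linear⟩
  one_mul := by ext; exact congrArg RMod.Hom.hom (MonObj.one_mul B)
  mul_one := by ext; exact congrArg RMod.Hom.hom (MonObj.mul_one B)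
  mul_assoc := by ext; exact congrArg RMod.Hom.hom (MonObj.mul_assoc B)
  counit := ⟨ε[B].hom, ε[B].linear, by
    rw [coact_unit]; exact coactR_natural ε[B].linear⟩
  comul := ⟨Δ[B].hom, Δ[B].linear, by
    rw [coact_ofRMod_tensor]; exact coactR_natural Δ[B].linear⟩
  counit_comul := by ext; exact congrArg RMod.Hom.hom (ComonObj.counit_comul B)
  comul_counit := by ext; exact congrArg RMod.Hom.hom (ComonObj.comul_counit B)
  comul_assoc := by ext; exact congrArg RMod.Hom.hom (ComonObj.comul_assoc B)
  mul_comul := by ext; exact congrArg RMod.Hom.hom (BimonObj.mul_comul B)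
  one_comul := by ext; exact congrArg RMod.Hom.hom (BimonObj.one_comul B)
  mul_counit := by ext; exact congrArg RMod.Hom.hom (BimonObj.mul_counit B)
  one_counit := by ext; exact congrArg RMod.Hom.hom (BimonObj.one_counit B)
  antipode := ⟨𝒮[B].hom, 𝒮[B].linear, coactR_natural 𝒮[B].linear⟩
  antipode_left := by ext; exact congrArg RMod.Hom.hom (HopfObj.antipode_left B)
  antipode_right := by ext; exact congrArg RMod.Hom.hom (HopfObj.antipode_right B)

end YetterDrinfeldHopf

/-! ### The Yetter-Drinfel'd braiding as a (co)distributive law -/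

section Laws
variable {C : Type u} [Category.{v} C] [MonoidalCategory C] [BraidedCategory C]
  {H : C} [BimonObj H]

/-- The regular coaction of `H` on itself. -/
theorem isCoaction_comul : IsCoaction Δ[H] where
  counit := by simp
  comul := by simp

theorem mul_colinear : diagCoact Δ[H] Δ[H] ≫ μ[H] ▷ H = μ[H] ≫ Δ[H] := by
  simp [diagCoact, MonoidalCategory.tensorHom_def']

theorem one_colinear : unitCoact H ≫ η[H] ▷ H = η[H] ≫ Δ[H] := by
  rw [BimonObj.one_comul, MonObj.tensorObj.one_def, unitCoact, MonoidalCategory.tensorHom_def',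
    Category.assoc, ← leftUnitor_inv_naturality_assoc]

theorem comul_linear : μ[H] ≫ Δ[H] = Δ[H] ▷ H ≫ diagAct μ[H] μ[H] := by
  simp [diagAct, MonoidalCategory.tensorHom_def]

theorem counit_linear : μ[H] ≫ ε[H] = ε[H] ▷ H ≫ unitAct H := by
  rw [BimonObj.mul_counit, unitAct, Comon.tensorObj_counit, MonoidalCategory.tensorHom_def,
    Category.assoc, leftUnitor_naturality]

variable {X Y : C} {a : X ⊗ H ⟶ X} {s : Y ⟶ Y ⊗ H}

theorem ydBraid_unitAct (hs : IsCoaction s) :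
    ydBraid (unitAct H) s = (λ_ Y).hom ≫ (ρ_ Y).inv := by
  simp only [ydBraid, unitAct, braiding_tensorUnit_left]
  calc
    _ = 𝟙 _ ⊗≫ (s ≫ Y ◁ ε[H]) ⊗≫ 𝟙 _ := by monoidal
    _ = _ := by rw [hs.counit]; monoidal

/-- The braiding with a module algebra `X` is compatible with its multiplication: it is natural for
linear morphisms, and the braiding with `X ⊗ X` is given by a hexagon. The same argument gives the
next three lemmas, with `Y` in place of `X` or comultiplications in place of multiplications. -/
theorem mul_ydBraid (hs : IsCoaction s) {m : X ⊗ X ⟶ X} (hm : diagAct a a ≫ m = m ▷ H ≫ a) :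
    m ▷ Y ≫ ydBraid a s = (α_ X X Y).hom ≫ X ◁ ydBraid a s ≫ (α_ X Y X).inv ≫
      ydBraid a s ▷ X ≫ (α_ Y X X).hom ≫ Y ◁ m := by
  have h := ydBraid_hexagon_reverse a a hs
  rw [Iso.inv_comp_eq, Iso.comp_inv_eq] at h
  rw [ydBraid_natural_left hm, h]
  simp

theorem ydBraid_mul (ha : IsAction a) {m : Y ⊗ Y ⟶ Y} (hm : diagCoact s s ≫ m ▷ H = m ≫ s) :
    X ◁ m ≫ ydBraid a s = (α_ X Y Y).inv ≫ ydBraid a s ▷ Y ≫ (α_ Y X Y).hom ≫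
      Y ◁ ydBraid a s ≫ (α_ Y Y X).inv ≫ m ▷ X := by
  have h := ydBraid_hexagon_forward ha s s
  rw [← Iso.eq_inv_comp, ← Iso.eq_comp_inv] at h
  rw [ydBraid_natural_right a hm, h]
  simp

theorem comul_ydBraid (hs : IsCoaction s) {d : X ⟶ X ⊗ X} (hd : a ≫ d = d ▷ H ≫ diagAct a a) :
    ydBraid a s ≫ Y ◁ d = d ▷ Y ≫ (α_ X X Y).hom ≫ X ◁ ydBraid a s ≫ (α_ X Y X).inv ≫
      ydBraid a s ▷ X ≫ (α_ Y X X).hom := by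
  have h := ydBraid_hexagon_reverse a a hs
  rw [Iso.inv_comp_eq, Iso.comp_inv_eq] at h
  rw [← ydBraid_natural_left hd, h]
  simp

theorem ydBraid_comul (ha : IsAction a) {d : Y ⟶ Y ⊗ Y} (hd : s ≫ d ▷ H = d ≫ diagCoact s s) :
    ydBraid a s ≫ d ▷ X = X ◁ d ≫ (α_ X Y Y).inv ≫ ydBraid a s ▷ Y ≫ (α_ Y X Y).hom ≫
      Y ◁ ydBraid a s ≫ (α_ Y Y X).inv := by
  have h := ydBraid_hexagon_forward ha s s
  rw [← Iso.eq_inv_comp, ← Iso.eq_comp_inv] at h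
  rw [← ydBraid_natural_right a hd, h]
  simp

theorem one_ydBraid (hs : IsCoaction s) {e : 𝟙_ C ⟶ X} (he : unitAct H ≫ e = e ▷ H ≫ a) :
    e ▷ Y ≫ ydBraid a s = (λ_ Y).hom ≫ (ρ_ Y).inv ≫ Y ◁ e := by
  rw [ydBraid_natural_left he, ydBraid_unitAct hs, Category.assoc]

theorem ydBraid_one (ha : IsAction a) {e : 𝟙_ C ⟶ Y} (he : unitCoact H ≫ e ▷ H = e ≫ s) :
    X ◁ e ≫ ydBraid a s = (ρ_ X).hom ≫ (λ_ X).inv ≫ e ▷ X := by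
  rw [ydBraid_natural_right a he, ydBraid_unit ha, Category.assoc]

theorem counit_ydBraid (hs : IsCoaction s) {c : X ⟶ 𝟙_ C} (hc : a ≫ c = c ▷ H ≫ unitAct H) :
    ydBraid a s ≫ Y ◁ c = c ▷ Y ≫ (λ_ Y).hom ≫ (ρ_ Y).inv := by
  rw [← ydBraid_natural_left hc, ydBraid_unitAct hs]

theorem ydBraid_counit (ha : IsAction a) {c : Y ⟶ 𝟙_ C} (hc : s ≫ c ▷ H = c ≫ unitCoact H) :
    ydBraid a s ≫ c ▷ X = X ◁ c ≫ (ρ_ X).hom ≫ (λ_ X).inv := by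
  rw [← ydBraid_natural_right a hc, ydBraid_unit ha]

/-- `(x h) ⊗ y ↦ y₍₀₎ ⊗ x (h y₍₁₎)`: the action of `H` on `X` is a linear morphism from the free
module `X ⊗ H`. -/
theorem act_ydBraid (ha : IsAction a) :
    a ▷ Y ≫ ydBraid a s = (α_ X H Y).hom ≫ X ◁ ydBraid μ[H] s ≫ (α_ X Y H).inv ≫
      (β_ X Y).hom ▷ H ≫ (α_ Y X H).hom ≫ Y ◁ a := by
  have h : ((α_ X H H).hom ≫ X ◁ μ[H]) ≫ a = a ▷ H ≫ a := by
    rw [Category.assoc, ha.mul, Iso.hom_inv_id_assoc]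
  rw [ydBraid_natural_left h]
  simp only [ydBraid]
  calc
    _ = 𝟙 _ ⊗≫ X ◁ H ◁ s ⊗≫ X ◁ (β_ H Y).hom ▷ H ⊗≫ ((β_ X Y).hom ▷ (H ⊗ H) ≫
          (Y ⊗ X) ◁ μ[H]) ⊗≫ Y ◁ a := by
      rw [BraidedCategory.braiding_tensor_left_hom]; monoidal
    _ = _ := by rw [← whisker_exchange]; monoidal

/-- The diagonal action acts on the second factor through the braiding with the regular comodule. -/
theorem diagAct_eq_ydBraid {b : Y ⊗ H ⟶ Y} :
    diagAct a b = (α_ X Y H).hom ≫ X ◁ ydBraid b Δ[H] ≫ (α_ X H Y).inv ≫ a ▷ Y := by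
  simp only [diagAct, ydBraid, tensorμ, MonoidalCategory.tensorHom_def']
  monoidal

end Laws

/-! ### Actions and multiplicative morphisms -/

section Algebra
variable {C : Type u} [Category.{v} C] [MonoidalCategory C]

theorem isAction_free {A : C} [MonObj A] (X : C) : IsAction ((α_ X A A).hom ≫ X ◁ μ[A]) where
  one := by
    calc
      _ = 𝟙 _ ⊗≫ X ◁ (A ◁ η[A] ≫ μ[A]) := by monoidal
      _ = _ := by rw [MonObj.mul_one]; monoidal
  mul := by
    calc
      _ = 𝟙 _ ⊗≫ X ◁ (A ◁ μ[A] ≫ μ[A]) := by monoidal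
      _ = _ := by rw [MonObj.mul_assoc_flip]; monoidal

/-- If the algebra `A` acts on the algebra `E` by right multiplication through a morphism
`d : A ⟶ E`, then `d` is the orbit map `x ↦ 1 x` of the unit of `E`, hence multiplicative. -/
theorem isMonHom_of_isAction {A E : C} [MonObj A] [MonObj E] {d : A ⟶ E}
    (h : IsAction (E ◁ d ≫ μ[E])) : IsMonHom d where
  one_hom := by
    have h1 := congrArg (fun f => (ρ_ (𝟙_ C)).inv ≫ η[E] ▷ 𝟙_ C ≫ f) h.one
    simp only [← whiskerLeft_comp_assoc] at h1
    rw [← whisker_exchange_assoc, MonObj.one_mul] at h1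
    calc
      _ = (ρ_ (𝟙_ C)).inv ≫ 𝟙_ C ◁ (η[A] ≫ d) ≫ (λ_ E).hom := by monoidal
      _ = _ := by rw [h1]; monoidal
  mul_hom := by
    have h1 := congrArg (fun f => (λ_ (A ⊗ A)).inv ≫ η[E] ▷ (A ⊗ A) ≫ f) h.mul
    simp only [← whiskerLeft_comp_assoc] at h1
    rw [← whisker_exchange_assoc, MonObj.one_mul] at h1
    calc
      _ = (λ_ (A ⊗ A)).inv ≫ 𝟙_ C ◁ (μ[A] ≫ d) ≫ (λ_ E).hom := by monoidal
      _ = 𝟙 _ ⊗≫ (η[E] ▷ A ≫ E ◁ d) ▷ A ⊗≫ μ[E] ▷ A ⊗≫ E ◁ d ⊗≫ μ[E] := by rw [h1]; monoidal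
      _ = 𝟙 _ ⊗≫ d ▷ A ⊗≫ (η[E] ▷ E ≫ μ[E]) ▷ A ⊗≫ E ◁ d ⊗≫ μ[E] := by
        rw [← whisker_exchange]; monoidal
      _ = _ := by rw [MonObj.one_mul, MonoidalCategory.tensorHom_def]; monoidal

end Algebra

/-! ### Actions of the cross product -/

section CrossAct
variable {C : Type u} [Category.{v} C] [MonoidalCategory C]

/-- The morphism `x ⊗ (h ⊗ b) ↦ (x h) b`. -/
def crossAct {H B X : C} (a : X ⊗ H ⟶ X) (t : X ⊗ B ⟶ X) : X ⊗ (H ⊗ B) ⟶ X :=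
  (α_ X H B).inv ≫ a ▷ B ≫ t

theorem crossAct_one {H B X : C} [MonObj H] {a : X ⊗ H ⟶ X} (ha : IsAction a) {t : X ⊗ B ⟶ X}
    {e : 𝟙_ C ⟶ B} (ht : X ◁ e ≫ t = (ρ_ X).hom) :
    X ◁ ((λ_ (𝟙_ C)).inv ≫ (η[H] ⊗ₘ e)) ≫ crossAct a t = (ρ_ X).hom := by
  simp only [crossAct, MonoidalCategory.tensorHom_def]
  calc
    _ = 𝟙 _ ⊗≫ X ◁ η[H] ⊗≫ ((X ⊗ H) ◁ e ≫ a ▷ B) ⊗≫ t := by monoidal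
    _ = 𝟙 _ ⊗≫ (X ◁ η[H] ≫ a) ⊗≫ (X ◁ e ≫ t) := by rw [whisker_exchange]; monoidal
    _ = _ := by rw [ha.one, ht]; monoidal

theorem crossAct_natural {H B X Y : C} {a : X ⊗ H ⟶ X} {t : X ⊗ B ⟶ X} {a' : Y ⊗ H ⟶ Y}
    {t' : Y ⊗ B ⟶ Y} {f : X ⟶ Y} (hf : a ≫ f = f ▷ H ≫ a') (hf' : t ≫ f = f ▷ B ≫ t') :
    crossAct a t ≫ f = f ▷ (H ⊗ B) ≫ crossAct a' t' := by
  simp only [crossAct, Category.assoc, hf']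
  rw [← comp_whiskerRight_assoc, hf]
  monoidal

variable [BraidedCategory C] {H B X Y : C} [BimonObj H]

/-- `x ((h ⊗ b) (h' ⊗ b')) = (x (h ⊗ b)) (h' ⊗ b')`: linearity of the action of `B` moves `h'` past
`b`. -/
theorem crossAct_mul {a : X ⊗ H ⟶ X} (ha : IsAction a) {b : B ⊗ H ⟶ B} {m : B ⊗ B ⟶ B}
    {t : X ⊗ B ⟶ X} (ht : X ◁ m ≫ t = (α_ X B B).inv ≫ t ▷ B ≫ t)
    (hl : diagAct a b ≫ t = t ▷ H ≫ a) :
    X ◁ crossMul b m ≫ crossAct a t =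
      (α_ X (H ⊗ B) (H ⊗ B)).inv ≫ crossAct a t ▷ (H ⊗ B) ≫ crossAct a t := by
  symm
  simp only [crossAct, crossMul, MonoidalCategory.tensorHom_def]
  calc
    _ = 𝟙 _ ⊗≫ a ▷ B ▷ H ▷ B ⊗≫ (t ▷ H ≫ a) ▷ B ⊗≫ t := by monoidal
    _ = 𝟙 _ ⊗≫ (a ▷ (B ⊗ H) ≫ X ◁ ydBraid b Δ[H]) ▷ B ⊗≫ a ▷ B ▷ B ⊗≫
          ((α_ X B B).inv ≫ t ▷ B ≫ t) := by
      rw [← hl, diagAct_eq_ydBraid]; monoidal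
    _ = 𝟙 _ ⊗≫ X ◁ H ◁ ydBraid b Δ[H] ▷ B ⊗≫
          ((α_ X H H).inv ≫ a ▷ H ≫ a) ▷ (B ⊗ B) ⊗≫ (X ◁ m ≫ t) := by
      rw [← whisker_exchange, ht]; monoidal
    _ = 𝟙 _ ⊗≫ X ◁ H ◁ ydBraid b Δ[H] ▷ B ⊗≫ X ◁ μ[H] ▷ (B ⊗ B) ⊗≫
          (a ▷ (B ⊗ B) ≫ X ◁ m) ⊗≫ t := by
      rw [← ha.mul]; monoidal
    _ = _ := by
      rw [← whisker_exchange]; monoidal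

/-- The multiplication of the cross product is the action on `H ⊗ B`, with the diagonal action of
`H` and the free action of `B`. -/
theorem crossMul_eq_crossAct (b : B ⊗ H ⟶ B) (m : B ⊗ B ⟶ B) :
    crossMul b m = crossAct (diagAct μ[H] b) ((α_ H B B).hom ≫ H ◁ m) := by
  simp only [crossAct, crossMul, diagAct_eq_ydBraid, MonoidalCategory.tensorHom_def]
  monoidal

theorem one_crossMul {b : B ⊗ H ⟶ B} {m : B ⊗ B ⟶ B} {e : 𝟙_ C ⟶ B}
    (he : unitAct H ≫ e = e ▷ H ≫ b) (hm : e ▷ B ≫ m = (λ_ B).hom) :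
    ((λ_ (𝟙_ C)).inv ≫ (η[H] ⊗ₘ e)) ▷ (H ⊗ B) ≫ crossMul b m = (λ_ (H ⊗ B)).hom := by
  simp only [crossMul, MonoidalCategory.tensorHom_def]
  calc
    _ = 𝟙 _ ⊗≫ η[H] ▷ (H ⊗ B) ⊗≫ H ◁ (e ▷ H ≫ ydBraid b Δ[H]) ▷ B ⊗≫ μ[H] ▷ (B ⊗ B) ⊗≫
          H ◁ m := by monoidal
    _ = 𝟙 _ ⊗≫ η[H] ▷ H ▷ B ⊗≫ ((H ⊗ H) ◁ (e ▷ B) ≫ μ[H] ▷ (B ⊗ B)) ⊗≫ H ◁ m := by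
      rw [one_ydBraid isCoaction_comul he]; monoidal
    _ = 𝟙 _ ⊗≫ (η[H] ▷ H ≫ μ[H]) ▷ B ⊗≫ H ◁ (e ▷ B ≫ m) := by
      rw [whisker_exchange]; monoidal
    _ = _ := by rw [MonObj.one_mul, hm]; monoidal

/-- An element `h ⊗ b` acts on a tensor product through `crossComul`, when `B` acts on the tensor
product through its comultiplication and the Yetter-Drinfel'd braiding. -/
theorem crossAct_tensor (a : X ⊗ H ⟶ X) {b : Y ⊗ H ⟶ Y} (hb : IsAction b) (t : X ⊗ B ⟶ X)
    (t' : Y ⊗ B ⟶ Y) (r : B ⟶ B ⊗ H) (d : B ⟶ B ⊗ B) :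
    crossAct (diagAct a b) ((X ⊗ Y) ◁ d ≫ ((α_ X Y (B ⊗ B)).hom ≫ X ◁ (α_ Y B B).inv ≫
        X ◁ ydBraid b r ▷ B ≫ X ◁ (α_ B Y B).hom ≫ (α_ X B (Y ⊗ B)).inv) ≫ (t ⊗ₘ t')) =
      (X ⊗ Y) ◁ crossComul r d ≫ tensorμ X Y (H ⊗ B) (H ⊗ B) ≫
        (crossAct a t ⊗ₘ crossAct b t') := by
  have h1 : crossAct a t ⊗ₘ crossAct b t' = 𝟙 _ ⊗≫ (X ⊗ H ⊗ B) ◁ (b ▷ B) ⊗≫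
      (a ▷ B) ▷ (Y ⊗ B) ⊗≫ (t ⊗ₘ t') := by
    rw [crossAct, crossAct, ← tensorHom_comp_tensorHom, ← tensorHom_comp_tensorHom,
      MonoidalCategory.tensorHom_def' (a ▷ B)]
    monoidal
  rw [h1]
  simp only [crossAct, crossComul, tensorμ, diagAct, MonoidalCategory.tensorHom_def' a b,
    MonoidalCategory.tensorHom_def' Δ[H] d, BraidedCategory.braiding_tensor_right_hom]
  calc
    _ = 𝟙 _ ⊗≫ (((X ⊗ Y) ◁ Δ[H] ⊗≫ X ◁ (β_ Y H).hom ▷ H ⊗≫ (X ⊗ H) ◁ b ⊗≫ a ▷ Y) ▷ B ≫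
          (X ⊗ Y) ◁ d) ⊗≫ X ◁ ydBraid b r ▷ B ⊗≫ (t ⊗ₘ t') := by monoidal
    _ = 𝟙 _ ⊗≫ (X ⊗ Y ⊗ H) ◁ d ⊗≫ (X ⊗ Y) ◁ Δ[H] ▷ (B ⊗ B) ⊗≫
          X ◁ (β_ Y H).hom ▷ (H ⊗ B ⊗ B) ⊗≫ (X ⊗ H) ◁ b ▷ (B ⊗ B) ⊗≫
          (a ▷ (Y ⊗ B) ≫ X ◁ ydBraid b r) ▷ B ⊗≫ (t ⊗ₘ t') := by
      rw [← whisker_exchange]; monoidal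
    _ = 𝟙 _ ⊗≫ (X ⊗ Y ⊗ H) ◁ d ⊗≫ (X ⊗ Y) ◁ Δ[H] ▷ (B ⊗ B) ⊗≫
          X ◁ (β_ Y H).hom ▷ (H ⊗ B ⊗ B) ⊗≫ (X ⊗ H) ◁ (b ▷ B ≫ ydBraid b r) ▷ B ⊗≫
          a ▷ (B ⊗ Y) ▷ B ⊗≫ (t ⊗ₘ t') := by
      rw [← whisker_exchange]; monoidal
    -- `(y h₍₂₎) b₍₁₎₍₁₎ = y (h₍₂₎ b₍₁₎₍₁₎)`
    _ = 𝟙 _ ⊗≫ (X ⊗ Y ⊗ H) ◁ d ⊗≫ (X ⊗ Y) ◁ Δ[H] ▷ (B ⊗ B) ⊗≫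
          X ◁ ((β_ Y H).hom ▷ (H ⊗ B) ≫ (H ⊗ Y) ◁ ydBraid μ[H] r) ▷ B ⊗≫
          X ◁ H ◁ (β_ Y B).hom ▷ (H ⊗ B) ⊗≫ X ◁ H ◁ B ◁ b ▷ B ⊗≫
          a ▷ (B ⊗ Y) ▷ B ⊗≫ (t ⊗ₘ t') := by
      rw [act_ydBraid hb]; monoidal
    _ = _ := by
      rw [← whisker_exchange]; monoidal

theorem crossAct_unit {c : B ⟶ 𝟙_ C} :
    crossAct (unitAct H) ((λ_ B).hom ≫ c) =
      (λ_ (H ⊗ B)).hom ≫ (ε[H] ⊗ₘ c) ≫ (λ_ (𝟙_ C)).hom := by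
  simp only [crossAct, unitAct, MonoidalCategory.tensorHom_def]
  monoidal

end CrossAct

/-! ### The coalgebra structure of the cross product -/

section CrossCoalgebra
variable {C : Type u} [Category.{v} C] [MonoidalCategory C] [BraidedCategory C]
  {H B : C} [BimonObj H] {r : B ⟶ B ⊗ H}

theorem counit_crossComul {d : B ⟶ B ⊗ B} {c : B ⟶ 𝟙_ C}
    (hc : r ≫ c ▷ H = c ≫ unitCoact H) (hd : d ≫ c ▷ B = (λ_ B).inv) :
    crossComul r d ≫ ((ε[H] ⊗ₘ c) ≫ (λ_ (𝟙_ C)).hom) ▷ (H ⊗ B) = (λ_ (H ⊗ B)).inv := by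
  simp only [crossComul, MonoidalCategory.tensorHom_def]
  calc
    _ = 𝟙 _ ⊗≫ Δ[H] ▷ B ⊗≫ (H ⊗ H) ◁ d ⊗≫ (H ◁ ydBraid μ[H] r ≫ ε[H] ▷ (B ⊗ H)) ▷ B ⊗≫
          c ▷ (H ⊗ B) ⊗≫ 𝟙 _ := by monoidal
    _ = 𝟙 _ ⊗≫ Δ[H] ▷ B ⊗≫ ((H ⊗ H) ◁ d ≫ (ε[H] ▷ H) ▷ (B ⊗ B)) ⊗≫
          (ydBraid μ[H] r ≫ c ▷ H) ▷ B ⊗≫ 𝟙 _ := by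
      rw [whisker_exchange]; monoidal
    _ = 𝟙 _ ⊗≫ (Δ[H] ≫ ε[H] ▷ H) ▷ B ⊗≫ H ◁ (d ≫ c ▷ B) ⊗≫ 𝟙 _ := by
      rw [whisker_exchange, ydBraid_counit isAction_mul hc]; monoidal
    _ = _ := by rw [ComonObj.counit_comul, hd]; monoidal

theorem crossComul_counit (hr : IsCoaction r) {d : B ⟶ B ⊗ B} {c : B ⟶ 𝟙_ C}
    (hd : d ≫ B ◁ c = (ρ_ B).inv) :
    crossComul r d ≫ (H ⊗ B) ◁ ((ε[H] ⊗ₘ c) ≫ (λ_ (𝟙_ C)).hom) = (ρ_ (H ⊗ B)).inv := by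
  simp only [crossComul, MonoidalCategory.tensorHom_def Δ[H] d,
    MonoidalCategory.tensorHom_def' ε[H] c]
  calc
    _ = 𝟙 _ ⊗≫ Δ[H] ▷ B ⊗≫ (H ⊗ H) ◁ d ⊗≫ H ◁ (ydBraid μ[H] r ▷ B ≫ (B ⊗ H) ◁ c) ⊗≫
          H ◁ B ◁ ε[H] ⊗≫ 𝟙 _ := by monoidal
    _ = 𝟙 _ ⊗≫ Δ[H] ▷ B ⊗≫ (H ⊗ H) ◁ (d ≫ B ◁ c) ⊗≫ H ◁ (ydBraid μ[H] r ≫ B ◁ ε[H]) ⊗≫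
          𝟙 _ := by
      rw [← whisker_exchange]; monoidal
    _ = 𝟙 _ ⊗≫ (Δ[H] ≫ H ◁ ε[H]) ▷ B ⊗≫ 𝟙 _ := by
      rw [counit_ydBraid hr counit_linear, hd]; monoidal
    _ = _ := by rw [ComonObj.comul_counit]; monoidal

/-- Both sides comultiply `h` and `b` twice and then braid `h₍₂₎` and `h₍₃₎` with `b₍₁₎`, and `h₍₃₎`
with `b₍₂₎`. They are brought to this form by `comul_ydBraid` and `ydBraid_comul`. -/
theorem crossComul_assoc (hr : IsCoaction r) {d : B ⟶ B ⊗ B}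
    (hd : r ≫ d ▷ H = d ≫ diagCoact r r) (hd' : d ≫ B ◁ d = d ≫ d ▷ B ≫ (α_ B B B).hom) :
    crossComul r d ≫ (H ⊗ B) ◁ crossComul r d =
      crossComul r d ≫ crossComul r d ▷ (H ⊗ B) ≫ (α_ _ _ _).hom := by
  simp only [crossComul, MonoidalCategory.tensorHom_def]
  trans 𝟙 _ ⊗≫ (Δ[H] ≫ Δ[H] ▷ H ≫ (α_ H H H).hom) ▷ B ⊗≫
      (H ⊗ H ⊗ H) ◁ (d ≫ B ◁ d) ⊗≫ H ◁ H ◁ ydBraid μ[H] r ▷ (B ⊗ B) ⊗≫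
      H ◁ ydBraid μ[H] r ▷ H ▷ (B ⊗ B) ⊗≫ H ◁ B ◁ H ◁ ydBraid μ[H] r ▷ B ⊗≫ 𝟙 _
  · calc
      _ = 𝟙 _ ⊗≫ Δ[H] ▷ B ⊗≫ (H ⊗ H) ◁ d ⊗≫ H ◁ (ydBraid μ[H] r ≫ B ◁ Δ[H]) ▷ B ⊗≫
            (H ⊗ B) ◁ (H ⊗ H) ◁ d ⊗≫ H ◁ B ◁ H ◁ ydBraid μ[H] r ▷ B ⊗≫ 𝟙 _ := by monoidal
      _ = 𝟙 _ ⊗≫ Δ[H] ▷ B ⊗≫ H ◁ (H ◁ d ≫ Δ[H] ▷ (B ⊗ B)) ⊗≫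
            H ◁ (((α_ H H B).hom ≫ H ◁ ydBraid μ[H] r ≫ (α_ H B H).inv ≫
              ydBraid μ[H] r ▷ H) ▷ B ≫ ((B ⊗ H) ⊗ H) ◁ d) ⊗≫
            H ◁ B ◁ H ◁ ydBraid μ[H] r ▷ B ⊗≫ 𝟙 _ := by
        rw [comul_ydBraid hr comul_linear]; monoidal
      _ = 𝟙 _ ⊗≫ (Δ[H] ≫ H ◁ Δ[H]) ▷ B ⊗≫ (H ⊗ H ⊗ H) ◁ (d ≫ B ◁ d) ⊗≫
            H ◁ H ◁ ydBraid μ[H] r ▷ (B ⊗ B) ⊗≫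
            H ◁ ydBraid μ[H] r ▷ H ▷ (B ⊗ B) ⊗≫ H ◁ B ◁ H ◁ ydBraid μ[H] r ▷ B ⊗≫ 𝟙 _ := by
        rw [← whisker_exchange _ d, whisker_exchange Δ[H] d]; monoidal
      _ = _ := by rw [ComonObj.comul_assoc]
  · symm
    calc
      _ = 𝟙 _ ⊗≫ Δ[H] ▷ B ⊗≫ (H ⊗ H) ◁ d ⊗≫ (H ◁ ydBraid μ[H] r ≫ Δ[H] ▷ (B ⊗ H)) ▷ B ⊗≫
            H ◁ (H ◁ d ≫ (α_ H B B).inv ≫ ydBraid μ[H] r ▷ B) ▷ (H ⊗ B) ⊗≫ 𝟙 _ := by monoidal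
      _ = 𝟙 _ ⊗≫ Δ[H] ▷ B ⊗≫ ((H ⊗ H) ◁ d ≫ Δ[H] ▷ H ▷ (B ⊗ B)) ⊗≫
            H ◁ H ◁ (ydBraid μ[H] r ≫ d ▷ H) ▷ B ⊗≫
            H ◁ ydBraid μ[H] r ▷ (B ⊗ H ⊗ B) ⊗≫ 𝟙 _ := by
        rw [whisker_exchange]; monoidal
      _ = 𝟙 _ ⊗≫ (Δ[H] ≫ Δ[H] ▷ H) ▷ B ⊗≫ (H ⊗ H ⊗ H) ◁ (d ≫ d ▷ B) ⊗≫
            H ◁ H ◁ ydBraid μ[H] r ▷ (B ⊗ B) ⊗≫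
            H ◁ (H ◁ (B ◁ ydBraid μ[H] r) ⊗≫ ydBraid μ[H] r ▷ (B ⊗ H)) ▷ B ⊗≫ 𝟙 _ := by
        rw [whisker_exchange, ydBraid_comul isAction_mul hd]; monoidal
      _ = 𝟙 _ ⊗≫ (Δ[H] ≫ Δ[H] ▷ H) ▷ B ⊗≫ (H ⊗ H ⊗ H) ◁ (d ≫ d ▷ B) ⊗≫
            H ◁ H ◁ ydBraid μ[H] r ▷ (B ⊗ B) ⊗≫
            H ◁ ((H ⊗ B) ◁ ydBraid μ[H] r ≫ ydBraid μ[H] r ▷ (B ⊗ H)) ▷ B ⊗≫ 𝟙 _ := by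
        monoidal
      _ = _ := by
        rw [whisker_exchange, hd']; monoidal

end CrossCoalgebra

/-! ### The antipode of the cross product -/

section CrossAntipode
variable {C : Type u} [Category.{v} C] [MonoidalCategory C] [BraidedCategory C]
  {H B : C} [HopfObj H] {a : B ⊗ H ⟶ B} {r : B ⟶ B ⊗ H} {m : B ⊗ B ⟶ B} {e : 𝟙_ C ⟶ B}
  {d : B ⟶ B ⊗ B} {c : B ⟶ 𝟙_ C} {s : B ⟶ B}

/-- Write `h b` for `h ⊗ b`. The antipode is `S(h b) = S(b₍₀₎) S(h b₍₁₎)`, and in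
`S(h₍₁₎ b₍₁₎₍₀₎) (h₍₂₎ b₍₁₎₍₁₎) b₍₂₎` the two factors from `H` cancel, as `h ⊗ b ↦ b₍₀₎ ⊗ h b₍₁₎`
is compatible with the comultiplication of `H`. -/
theorem crossAntipode_left (ha : IsAction a) (hr : IsCoaction r)
    (hs : d ≫ s ▷ B ≫ m = c ≫ e) :
    crossComul r d ≫ crossAntipode a r s ▷ (H ⊗ B) ≫ crossMul a m =
      ((ε[H] ⊗ₘ c) ≫ (λ_ (𝟙_ C)).hom) ≫ (λ_ (𝟙_ C)).inv ≫ (η[H] ⊗ₘ e) := by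
  have key : (α_ B H H).inv ≫ ydBraid a Δ[H] ▷ H ≫ (α_ H B H).hom ≫ H ◁ ydBraid a Δ[H] ≫
      (α_ H H B).inv ≫ μ[H] ▷ B = B ◁ μ[H] ≫ ydBraid a Δ[H] :=
    (ydBraid_mul ha mul_colinear).symm
  have key' : ydBraid μ[H] r ≫ B ◁ Δ[H] = Δ[H] ▷ B ≫ (α_ H H B).hom ≫ H ◁ ydBraid μ[H] r ≫
      (α_ H B H).inv ≫ ydBraid μ[H] r ▷ H ≫ (α_ B H H).hom :=
    comul_ydBraid hr comul_linear
  simp only [crossComul, crossAntipode, crossMul, MonoidalCategory.tensorHom_def]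
  calc
    _ = 𝟙 _ ⊗≫ (Δ[H] ▷ B ≫ (H ⊗ H) ◁ d) ⊗≫ H ◁ ydBraid μ[H] r ▷ B ⊗≫
          ydBraid μ[H] r ▷ (H ⊗ B) ⊗≫ s ▷ H ▷ H ▷ B ⊗≫ B ◁ 𝒮[H] ▷ H ▷ B ⊗≫
          ((α_ B H H).inv ≫ ydBraid a Δ[H] ▷ H ≫ (α_ H B H).hom ≫ H ◁ ydBraid a Δ[H] ≫
            (α_ H H B).inv ≫ μ[H] ▷ B) ▷ B ⊗≫ H ◁ m := by monoidal
    -- `b h h'` is computed as `b (h h')`, by the multiplication of `H`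
    _ = 𝟙 _ ⊗≫ H ◁ d ⊗≫ (Δ[H] ▷ B ≫ (α_ H H B).hom ≫ H ◁ ydBraid μ[H] r ≫
      (α_ H B H).inv ≫ ydBraid μ[H] r ▷ H ≫ (α_ B H H).hom) ▷ B ⊗≫ (s ▷ (H ⊗ H) ≫
          B ◁ (𝒮[H] ▷ H ≫ μ[H])) ▷ B ⊗≫ ydBraid a Δ[H] ▷ B ⊗≫ H ◁ m := by
      rw [key, ← whisker_exchange]; monoidal
    _ = 𝟙 _ ⊗≫ H ◁ d ⊗≫ ydBraid μ[H] r ▷ B ⊗≫ B ◁ (Δ[H] ≫ 𝒮[H] ▷ H ≫ μ[H]) ▷ B ⊗≫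
          (s ▷ H ≫ ydBraid a Δ[H]) ▷ B ⊗≫ H ◁ m := by
      rw [← whisker_exchange, ← key']; monoidal
    _ = 𝟙 _ ⊗≫ H ◁ d ⊗≫ (ydBraid μ[H] r ≫ B ◁ ε[H]) ▷ B ⊗≫ (B ◁ η[H] ≫ s ▷ H) ▷ B ⊗≫
          ydBraid a Δ[H] ▷ B ⊗≫ H ◁ m := by
      rw [HopfObj.antipode_left]; monoidal
    _ = 𝟙 _ ⊗≫ (H ◁ d ≫ ε[H] ▷ (B ⊗ B)) ⊗≫ s ▷ B ⊗≫ (B ◁ η[H] ≫ ydBraid a Δ[H]) ▷ B ⊗≫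
          H ◁ m := by
      rw [whisker_exchange, counit_ydBraid hr counit_linear]; monoidal
    _ = 𝟙 _ ⊗≫ ε[H] ▷ B ⊗≫ d ⊗≫ s ▷ B ⊗≫ (η[H] ▷ (B ⊗ B) ≫ H ◁ m) := by
      rw [whisker_exchange, ydBraid_one ha one_colinear]; monoidal
    _ = 𝟙 _ ⊗≫ ε[H] ▷ B ⊗≫ (d ≫ s ▷ B ≫ m) ⊗≫ η[H] ▷ B := by
      rw [← whisker_exchange]; monoidal
    _ = 𝟙 _ ⊗≫ ε[H] ▷ B ⊗≫ c ⊗≫ (𝟙_ C ◁ e ≫ η[H] ▷ B) := by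
      rw [hs]; monoidal
    _ = _ := by rw [whisker_exchange]; monoidal

/-- In `h₍₁₎ b₍₁₎₍₀₎ S(b₍₂₎₍₀₎) S(h₍₂₎ b₍₁₎₍₁₎ b₍₂₎₍₁₎)` the two factors from `B` cancel, as
`h ⊗ b ↦ b₍₀₎ ⊗ h b₍₁₎` is compatible with the comultiplication of `B`. -/
theorem crossAntipode_right (hm : diagAct a a ≫ m = m ▷ H ≫ a)
    (he : unitAct H ≫ e = e ▷ H ≫ a) (hd : r ≫ d ▷ H = d ≫ diagCoact r r)
    (hc : r ≫ c ▷ H = c ≫ unitCoact H) (hs : d ≫ B ◁ s ≫ m = c ≫ e) :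
    crossComul r d ≫ (H ⊗ B) ◁ crossAntipode a r s ≫ crossMul a m =
      ((ε[H] ⊗ₘ c) ≫ (λ_ (𝟙_ C)).hom) ≫ (λ_ (𝟙_ C)).inv ≫ (η[H] ⊗ₘ e) := by
  have key : (α_ B B H).hom ≫ B ◁ ydBraid a Δ[H] ≫ (α_ B H B).inv ≫ ydBraid a Δ[H] ▷ B ≫
      (α_ H B B).hom ≫ H ◁ m = m ▷ H ≫ ydBraid a Δ[H] :=
    (mul_ydBraid isCoaction_comul hm).symm
  have key' : ydBraid μ[H] r ≫ d ▷ H = H ◁ d ≫ (α_ H B B).inv ≫ ydBraid μ[H] r ▷ B ≫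
      (α_ B H B).hom ≫ B ◁ ydBraid μ[H] r ≫ (α_ B B H).inv :=
    ydBraid_comul isAction_mul hd
  simp only [crossComul, crossAntipode, crossMul, MonoidalCategory.tensorHom_def Δ[H] d,
    MonoidalCategory.tensorHom_def s 𝒮[H], MonoidalCategory.tensorHom_def' μ[H] m,
    MonoidalCategory.tensorHom_def ε[H] c, MonoidalCategory.tensorHom_def η[H] e]
  calc
    _ = 𝟙 _ ⊗≫ Δ[H] ▷ B ⊗≫ H ◁ (H ◁ d ≫ (α_ H B B).inv ≫ ydBraid μ[H] r ▷ B ≫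
          (α_ B H B).hom ≫ B ◁ ydBraid μ[H] r ≫ (α_ B B H).inv) ⊗≫
          (H ⊗ B) ◁ s ▷ H ⊗≫ (H ⊗ B ⊗ B) ◁ 𝒮[H] ⊗≫ H ◁ ((α_ B B H).hom ≫
          B ◁ ydBraid a Δ[H] ≫ (α_ B H B).inv ≫ (ydBraid a Δ[H] ▷ B) ≫
      (α_ H B B).hom ≫ H ◁ m) ⊗≫ μ[H] ▷ B := by
      monoidal
    -- the coaction of `b₍₁₎ ⊗ b₍₂₎` is that of `b`, and `b b' h` is computed as `(b b') h`
    _ = 𝟙 _ ⊗≫ Δ[H] ▷ B ⊗≫ H ◁ ydBraid μ[H] r ⊗≫ H ◁ d ▷ H ⊗≫ (H ⊗ B) ◁ s ▷ H ⊗≫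
          H ◁ ((B ⊗ B) ◁ 𝒮[H] ≫ m ▷ H) ⊗≫ H ◁ ydBraid a Δ[H] ⊗≫ μ[H] ▷ B := by
      rw [key, ← key']; monoidal
    _ = 𝟙 _ ⊗≫ Δ[H] ▷ B ⊗≫ H ◁ ydBraid μ[H] r ⊗≫ H ◁ (d ≫ B ◁ s ≫ m) ▷ H ⊗≫
          H ◁ B ◁ 𝒮[H] ⊗≫ H ◁ ydBraid a Δ[H] ⊗≫ μ[H] ▷ B := by
      rw [whisker_exchange]; monoidal
    _ = 𝟙 _ ⊗≫ Δ[H] ▷ B ⊗≫ H ◁ (ydBraid μ[H] r ≫ c ▷ H) ⊗≫ H ◁ (e ▷ H ≫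
          B ◁ 𝒮[H]) ⊗≫ H ◁ ydBraid a Δ[H] ⊗≫ μ[H] ▷ B := by
      rw [hs]; monoidal
    _ = 𝟙 _ ⊗≫ Δ[H] ▷ B ⊗≫ (H ⊗ H) ◁ c ⊗≫ H ◁ 𝒮[H] ⊗≫ H ◁ (e ▷ H ≫ ydBraid a Δ[H]) ⊗≫
          μ[H] ▷ B := by
      rw [← whisker_exchange, ydBraid_counit isAction_mul hc]; monoidal
    _ = 𝟙 _ ⊗≫ (Δ[H] ▷ B ≫ (H ⊗ H) ◁ c) ⊗≫ H ◁ 𝒮[H] ⊗≫ ((H ⊗ H) ◁ e ≫ μ[H] ▷ B) := by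
      rw [one_ydBraid isCoaction_comul he]; monoidal
    _ = 𝟙 _ ⊗≫ H ◁ c ⊗≫ (Δ[H] ≫ H ◁ 𝒮[H] ≫ μ[H]) ⊗≫ H ◁ e := by
      rw [whisker_exchange, ← whisker_exchange]; monoidal
    _ = 𝟙 _ ⊗≫ (H ◁ c ≫ ε[H] ▷ 𝟙_ C) ⊗≫ η[H] ⊗≫ H ◁ e := by
      rw [HopfObj.antipode_right]; monoidal
    _ = _ := by rw [whisker_exchange]; monoidal

end CrossAntipode

/-! ### The factors of the cross product -/

section Factors
variable {C : Type u} [Category.{v} C] [MonoidalCategory C]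

/-- The inclusion `h ↦ h ⊗ 1` of the first factor of a cross product. -/
def inlCross (H : C) {B : C} (e : 𝟙_ C ⟶ B) : H ⟶ H ⊗ B := (ρ_ H).inv ≫ H ◁ e

/-- The inclusion `b ↦ 1 ⊗ b` of the second factor of a cross product. -/
def inrCross (H B : C) [MonObj H] : B ⟶ H ⊗ B := (λ_ B).inv ≫ η[H] ▷ B

theorem one_inlCross {H B : C} [MonObj H] (e : 𝟙_ C ⟶ B) :
    η[H] ≫ inlCross H e = (λ_ (𝟙_ C)).inv ≫ (η[H] ⊗ₘ e) := by
  simp only [inlCross, MonoidalCategory.tensorHom_def]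
  rw [rightUnitor_inv_naturality_assoc]
  monoidal

theorem one_inrCross {H B : C} [MonObj H] (e : 𝟙_ C ⟶ B) :
    e ≫ inrCross H B = (λ_ (𝟙_ C)).inv ≫ (η[H] ⊗ₘ e) := by
  simp only [inrCross, MonoidalCategory.tensorHom_def']
  rw [leftUnitor_inv_naturality_assoc]

/-- Acting through `f` and then through `g` is acting through the product of `f` and `g`. -/
theorem IsAction.restrict_restrict {A X U V : C} [MonObj A] {n : X ⊗ A ⟶ X} (hn : IsAction n)
    (f : U ⟶ A) (g : V ⟶ A) :
    (X ◁ f ≫ n) ▷ V ≫ X ◁ g ≫ n = (α_ X U V).hom ≫ X ◁ ((f ⊗ₘ g) ≫ μ[A]) ≫ n := by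
  rw [whiskerLeft_comp, Category.assoc, hn.mul]
  calc
    _ = 𝟙 _ ⊗≫ X ◁ f ▷ V ⊗≫ (n ▷ V ≫ X ◁ g) ≫ n := by monoidal
    _ = _ := by rw [← whisker_exchange, MonoidalCategory.tensorHom_def]; monoidal

variable [BraidedCategory C] {H B : C} [BimonObj H] {b : B ⊗ H ⟶ B} {m : B ⊗ B ⟶ B}
  {e : 𝟙_ C ⟶ B}

/-- `(h ⊗ 1) (h' ⊗ b) = h h' ⊗ b` -/
theorem inlCross_crossMul (he : unitAct H ≫ e = e ▷ H ≫ b) (hm : e ▷ B ≫ m = (λ_ B).hom) :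
    inlCross H e ▷ (H ⊗ B) ≫ crossMul b m = (α_ H H B).inv ≫ μ[H] ▷ B := by
  simp only [inlCross, crossMul, MonoidalCategory.tensorHom_def']
  calc
    _ = 𝟙 _ ⊗≫ H ◁ (e ▷ H ≫ ydBraid b Δ[H]) ▷ B ⊗≫ (H ⊗ H) ◁ m ⊗≫ μ[H] ▷ B := by monoidal
    _ = 𝟙 _ ⊗≫ (H ⊗ H) ◁ (e ▷ B ≫ m) ⊗≫ μ[H] ▷ B := by
      rw [one_ydBraid isCoaction_comul he]; monoidal
    _ = _ := by rw [hm]; monoidal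

/-- `(h ⊗ b) (1 ⊗ b') = h ⊗ b b'` -/
theorem crossMul_inrCross (hb : IsAction b) :
    (H ⊗ B) ◁ inrCross H B ≫ crossMul b m = (α_ H B B).hom ≫ H ◁ m := by
  simp only [inrCross, crossMul, MonoidalCategory.tensorHom_def]
  calc
    _ = 𝟙 _ ⊗≫ H ◁ (B ◁ η[H] ≫ ydBraid b Δ[H]) ▷ B ⊗≫ μ[H] ▷ (B ⊗ B) ⊗≫ H ◁ m := by monoidal
    _ = 𝟙 _ ⊗≫ (H ◁ η[H] ≫ μ[H]) ▷ (B ⊗ B) ⊗≫ H ◁ m := by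
      rw [ydBraid_one hb one_colinear]; monoidal
    _ = _ := by rw [MonObj.mul_one]; monoidal

theorem mul_inlCross (he : unitAct H ≫ e = e ▷ H ≫ b) (hm : e ▷ B ≫ m = (λ_ B).hom) :
    μ[H] ≫ inlCross H e = (inlCross H e ⊗ₘ inlCross H e) ≫ crossMul b m := by
  rw [MonoidalCategory.tensorHom_def', Category.assoc, inlCross_crossMul he hm]
  simp only [inlCross]
  calc
    _ = 𝟙 _ ⊗≫ (μ[H] ▷ 𝟙_ C ≫ H ◁ e) := by monoidal
    _ = _ := by rw [← whisker_exchange]; monoidal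

theorem mul_inrCross (hb : IsAction b) :
    m ≫ inrCross H B = (inrCross H B ⊗ₘ inrCross H B) ≫ crossMul b m := by
  rw [MonoidalCategory.tensorHom_def, Category.assoc, crossMul_inrCross hb]
  simp only [inrCross]
  calc
    _ = 𝟙 _ ⊗≫ (𝟙_ C ◁ m ≫ η[H] ▷ B) := by monoidal
    _ = _ := by rw [whisker_exchange]; monoidal

theorem inlCross_inrCross (hb : IsAction b) (hm : e ▷ B ≫ m = (λ_ B).hom) :
    (inlCross H e ⊗ₘ inrCross H B) ≫ crossMul b m = 𝟙 (H ⊗ B) := by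
  rw [MonoidalCategory.tensorHom_def, Category.assoc, crossMul_inrCross hb]
  simp only [inlCross]
  calc
    _ = 𝟙 _ ⊗≫ H ◁ (e ▷ B ≫ m) := by monoidal
    _ = _ := by rw [hm]; monoidal

/-- The two factors of a cross product commute up to the Yetter-Drinfel'd braiding:
`(1 ⊗ b) (h ⊗ 1) = h₍₁₎ ⊗ b h₍₂₎`. -/
theorem inrCross_inlCross (hm : B ◁ e ≫ m = (ρ_ B).hom) :
    (inrCross H B ⊗ₘ inlCross H e) ≫ crossMul b m = ydBraid b Δ[H] := by
  simp only [inlCross, inrCross, crossMul, MonoidalCategory.tensorHom_def]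
  calc
    _ = 𝟙 _ ⊗≫ η[H] ▷ (B ⊗ H) ⊗≫ H ◁ (((B ⊗ H) ◁ e) ≫ ydBraid b Δ[H] ▷ B) ⊗≫
          μ[H] ▷ (B ⊗ B) ⊗≫ H ◁ m := by monoidal
    _ = 𝟙 _ ⊗≫ (η[H] ▷ (B ⊗ H) ≫ H ◁ ydBraid b Δ[H]) ⊗≫ ((H ⊗ H) ◁ B ◁ e ≫
          μ[H] ▷ (B ⊗ B)) ⊗≫ H ◁ m := by rw [whisker_exchange]; monoidal
    _ = 𝟙 _ ⊗≫ ydBraid b Δ[H] ⊗≫ (η[H] ▷ H ≫ μ[H]) ▷ B ⊗≫ H ◁ (B ◁ e ≫ m) := by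
      rw [whisker_exchange, ← whisker_exchange]; monoidal
    _ = _ := by rw [MonObj.one_mul, hm]; monoidal

end Factors

/-! ### The bosonization -/

section CrossProduct
variable {C : Type u} [Category.{v} C] [MonoidalCategory C] [BraidedCategory C] {H : C}

/-- The regular module of an algebra. -/
def RMod.regular (A : C) [MonObj A] : RMod A := ⟨A, μ[A], isAction_mul⟩

/-- The free `B`-module on the regular `H`-module. Its underlying object is `H ⊗ B`, and it
corresponds to the regular module of the cross product. -/
def RMod.regularCross [BimonObj H] (B : RMod H) [MonObj B] : RMod B :=
  ⟨RMod.regular H ⊗ B, (α_ (RMod.regular H) B B).hom ≫ RMod.regular H ◁ μ[B], isAction_free _⟩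

/-- The action `m (h ⊗ b) = (m h) b` on a `B`-module in the category of `H`-modules. -/
def actCross [BimonObj H] {B : RMod H} [MonObj B] (M : RMod B) :
    M.X.X ⊗ (H ⊗ B.X) ⟶ M.X.X :=
  crossAct M.X.act M.act.hom

theorem actCross_mul [BimonObj H] {B : RMod H} [MonObj B] (M : RMod B) :
    M.X.X ◁ crossMul B.act μ[B].hom ≫ actCross M =
      (α_ M.X.X (H ⊗ B.X) (H ⊗ B.X)).inv ≫ actCross M ▷ (H ⊗ B.X) ≫ actCross M :=
  crossAct_mul M.X.isAction (congrArg RMod.Hom.hom M.isAction.mul) M.act.linear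

theorem actCross_regularCross [BimonObj H] (B : RMod H) [MonObj B] :
    actCross (RMod.regularCross B) = crossMul B.act μ[B].hom :=
  (crossMul_eq_crossAct B.act μ[B].hom).symm

/-- The algebra structure of the cross product `H ⋉ B`. -/
@[reducible]
def crossMonObj [BimonObj H] (B : RMod H) [MonObj B] : MonObj (H ⊗ B.X) where
  one := (λ_ (𝟙_ C)).inv ≫ (η[H] ⊗ₘ η[B].hom)
  mul := crossMul B.act μ[B].hom
  one_mul := one_crossMul η[B].linear (congrArg RMod.Hom.hom (MonObj.one_mul B))
  mul_one := by
    rw [← actCross_regularCross]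
    exact crossAct_one (RMod.regularCross B).X.isAction
      (congrArg RMod.Hom.hom (RMod.regularCross B).isAction.one)
  mul_assoc := by
    have h := actCross_mul (RMod.regularCross B)
    rw [actCross_regularCross] at h
    exact ((Iso.eq_inv_comp _).1 h).symm

theorem isAction_actCross [BimonObj H] {B : RMod H} [MonObj B] (M : RMod B) :
    letI := crossMonObj B
    IsAction (actCross M) :=
  letI := crossMonObj B
  ⟨crossAct_one M.X.isAction (congrArg RMod.Hom.hom M.isAction.one), actCross_mul M⟩

variable [HopfObj H] [IsIso 𝒮[H]] [Quasitriangular H] [SymmetricOnModules H]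

/-- The tensor product of `B`-modules corresponds to the comultiplication of the cross product. -/
theorem actCross_tensor {B : RMod H} [BimonObj B] (M N : RMod B) :
    actCross (M ⊗ N) = (M.X.X ⊗ N.X.X) ◁ crossComul (B := B.X) (YD.ofRMod B).coact Δ[B].hom ≫
      tensorμ M.X.X N.X.X (H ⊗ B.X) (H ⊗ B.X) ≫ (actCross M ⊗ₘ actCross N) :=
  crossAct_tensor M.X.act N.X.isAction M.act.hom N.act.hom _ Δ[B].hom

theorem actCross_unit {B : RMod H} [BimonObj B] :
    actCross (𝟙_ (RMod B)) =
      (λ_ (H ⊗ B.X)).hom ≫ (ε[H] ⊗ₘ ε[B].hom) ≫ (λ_ (𝟙_ C)).hom :=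
  crossAct_unit

/-- The bosonization: the Hopf algebra structure of the cross product `H ⋉ B`. The comultiplication
and the counit are multiplicative because `H ⋉ B` acts through them on the tensor square of its
regular module and on the unit object. -/
@[reducible]
noncomputable def crossHopfObj (B : RMod H) [HopfObj B] : HopfObj (H ⊗ B.X) :=
  letI := crossMonObj B
  letI := YD.hopfObjOfRMod B
  have comul : IsMonHom (crossComul (B := B.X) (YD.ofRMod B).coact Δ[B].hom) := by
    apply isMonHom_of_isAction
    have h := isAction_actCross (RMod.regularCross B ⊗ RMod.regularCross B)
    rw [actCross_tensor, actCross_regularCross] at h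
    exact h
  have counit : IsMonHom ((ε[H] ⊗ₘ ε[B].hom) ≫ (λ_ (𝟙_ C)).hom) := by
    apply isMonHom_of_isAction
    have h := isAction_actCross (𝟙_ (RMod B))
    rw [actCross_unit, ← leftUnitor_naturality] at h
    exact h
  { counit := (ε[H] ⊗ₘ ε[B].hom) ≫ (λ_ (𝟙_ C)).hom
    comul := crossComul (YD.ofRMod B).coact Δ[B].hom
    counit_comul := counit_crossComul ε[YD.ofRMod B].colinear
      (congrArg RMod.Hom.hom (ComonObj.counit_comul B))
    comul_counit := crossComul_counit (YD.ofRMod B).isCoaction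
      (congrArg RMod.Hom.hom (ComonObj.comul_counit B))
    comul_assoc := crossComul_assoc (YD.ofRMod B).isCoaction Δ[YD.ofRMod B].colinear
      (congrArg RMod.Hom.hom (ComonObj.comul_assoc B))
    mul_comul := comul.mul_hom
    one_comul := comul.one_hom
    mul_counit := counit.mul_hom
    one_counit := counit.one_hom
    antipode := crossAntipode B.act (YD.ofRMod B).coact 𝒮[B].hom
    antipode_left := crossAntipode_left B.isAction (YD.ofRMod B).isCoaction
      (congrArg RMod.Hom.hom (HopfObj.antipode_left B))
    antipode_right := crossAntipode_right μ[B].linear η[B].linear Δ[YD.ofRMod B].colinear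
      ε[YD.ofRMod B].colinear (congrArg RMod.Hom.hom (HopfObj.antipode_right B)) }

end CrossProduct

/-! ### Equality of modules -/

section Equality
variable {C : Type u} [Category.{v} C] [MonoidalCategory C]

/-- Modules on the same object with the same action are equal. -/
theorem RMod.ext_act {A : C} [MonObj A] {X : C} {a a' : X ⊗ A ⟶ X} {ha : IsAction a}
    {ha' : IsAction a'} (h : a = a') : (⟨X, a, ha⟩ : RMod A) = ⟨X, a', ha'⟩ := by
  subst h; rfl

/-- Morphisms of modules are conjugate by equalities of modules if the underlying morphisms are. -/
theorem RMod.hom_ext_eqToHom {A : C} [MonObj A] {M M' N N' : RMod A} (p : M = M') (q : N' = N)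
    {f : M ⟶ N} {g : M' ⟶ N'}
    (h : f.hom = eqToHom (congrArg RMod.X p) ≫ g.hom ≫ eqToHom (congrArg RMod.X q)) :
    f = eqToHom p ≫ g ≫ eqToHom q := by
  subst p q
  ext
  simpa using h

variable [BraidedCategory C] {H : C} [BimonObj H] {B : RMod H} [MonObj B]

/-- Modules in the category of `H`-modules are equal if they have the same underlying object of
`C` and the same two actions on it. -/
theorem RMod.ext_act₂ {X : C} {a a' : X ⊗ H ⟶ X} {ha : IsAction a} {ha' : IsAction a'}
    {t : (⟨X, a, ha⟩ : RMod H) ⊗ B ⟶ ⟨X, a, ha⟩} {t' : (⟨X, a', ha'⟩ : RMod H) ⊗ B ⟶ ⟨X, a', ha'⟩}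
    {ht : IsAction t} {ht' : IsAction t'} (h : a = a') (h' : t.hom = t'.hom) :
    (⟨⟨X, a, ha⟩, t, ht⟩ : RMod B) = ⟨⟨X, a', ha'⟩, t', ht'⟩ := by
  subst h
  exact RMod.ext_act (RMod.hom_ext h')

end Equality

/-! ### Modules over the bosonization -/

section CrossModules
variable {C : Type u} [Category.{v} C] [MonoidalCategory C] [BraidedCategory C] {H : C}
  [HopfObj H] [IsIso 𝒮[H]] [Quasitriangular H] [SymmetricOnModules H]

attribute [local instance] crossHopfObj

/-- A `B`-module in the category of `H`-modules is a module over the cross product `H ⋉ B`. -/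
def RMod.toCross (B : RMod H) [HopfObj B] : RMod B ⥤ RMod (H ⊗ B.X) where
  obj M := ⟨M.X.X, actCross M, isAction_actCross M⟩
  map f := ⟨f.hom.hom, crossAct_natural f.hom.linear (congrArg RMod.Hom.hom f.linear)⟩

/-- The underlying algebra of an algebra in the category of `H`-modules. -/
@[reducible]
def RMod.monObjX (B : RMod H) [MonObj B] : MonObj B.X where
  one := η[B].hom
  mul := μ[B].hom
  one_mul := congrArg RMod.Hom.hom (MonObj.one_mul B)
  mul_one := congrArg RMod.Hom.hom (MonObj.mul_one B)
  mul_assoc := congrArg RMod.Hom.hom (MonObj.mul_assoc B)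

/-- An action of the cross product is determined by the actions of its two factors. -/
theorem crossAct_restrict (B : RMod H) [HopfObj B] (N : RMod (H ⊗ B.X)) :
    crossAct (N.X ◁ inlCross H η[B].hom ≫ N.act) (N.X ◁ inrCross H B.X ≫ N.act) = N.act := by
  have h : (inlCross H η[B].hom ⊗ₘ inrCross H B.X) ≫ μ[H ⊗ B.X] = 𝟙 _ :=
    inlCross_inrCross B.isAction (congrArg RMod.Hom.hom (MonObj.one_mul B))
  rw [crossAct, N.isAction.restrict_restrict, h]
  simp

/-- The restricted action of `B` is `H`-linear, by `inrCross_inlCross`. -/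
theorem diagAct_restrict (B : RMod H) [HopfObj B] (N : RMod (H ⊗ B.X)) :
    diagAct (N.X ◁ inlCross H η[B].hom ≫ N.act) B.act ≫ N.X ◁ inrCross H B.X ≫ N.act =
      (N.X ◁ inrCross H B.X ≫ N.act) ▷ H ≫ N.X ◁ inlCross H η[B].hom ≫ N.act := by
  have h := crossAct_restrict B N
  have h' : (inrCross H B.X ⊗ₘ inlCross H η[B].hom) ≫ μ[H ⊗ B.X] = ydBraid B.act Δ[H] :=
    inrCross_inlCross (congrArg RMod.Hom.hom (MonObj.mul_one B))
  rw [crossAct, Iso.inv_comp_eq] at h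
  rw [diagAct_eq_ydBraid, Category.assoc, Category.assoc, Category.assoc, h,
    Iso.inv_hom_id_assoc, N.isAction.restrict_restrict, h']

/-- The algebra structure of `B.X` is passed explicitly: as an instance it would induce a second
algebra structure on `H ⊗ B.X`, that of the tensor product. -/
theorem isAction_restrict_inrCross (B : RMod H) [HopfObj B] (N : RMod (H ⊗ B.X)) :
    @IsAction C _ _ B.X B.monObjX N.X (N.X ◁ inrCross H B.X ≫ N.act) :=
  @IsAction.restrict _ _ _ _ _ _ B.monObjX _ _ N.isAction _ (one_inrCross _)
    (mul_inrCross B.isAction)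

/-- A module over the cross product restricts to its two factors. -/
def RMod.ofCross (B : RMod H) [HopfObj B] : RMod (H ⊗ B.X) ⥤ RMod B where
  obj N :=
    { X := ⟨N.X, N.X ◁ inlCross H η[B].hom ≫ N.act,
        N.isAction.restrict (one_inlCross _)
          (mul_inlCross η[B].linear (congrArg RMod.Hom.hom (MonObj.one_mul B)))⟩
      act := ⟨N.X ◁ inrCross H B.X ≫ N.act, diagAct_restrict B N⟩
      isAction :=
        ⟨RMod.hom_ext (@IsAction.one _ _ _ _ B.monObjX _ _ (isAction_restrict_inrCross B N)),
          RMod.hom_ext (@IsAction.mul _ _ _ _ B.monObjX _ _ (isAction_restrict_inrCross B N))⟩ }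
  map f := ⟨⟨f.hom, by
      rw [Category.assoc, f.linear, whisker_exchange_assoc]⟩, by
    ext
    change (_ ◁ _ ≫ _) ≫ f.hom = f.hom ▷ _ ≫ _ ◁ _ ≫ _
    rw [Category.assoc, f.linear, whisker_exchange_assoc]⟩

/-- The isomorphism `RMod.toCross` is strict monoidal: its structure morphisms are identities. -/
noncomputable instance (B : RMod H) [HopfObj B] : (RMod.toCross B).Monoidal :=
  Functor.CoreMonoidal.toMonoidal
    { εIso := RMod.mkIso (Iso.refl (𝟙_ C)) (by
        change unitAct (H ⊗ B.X) ≫ 𝟙 _ = 𝟙 (𝟙_ C) ▷ (H ⊗ B.X) ≫ actCross (𝟙_ (RMod B))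
        rw [actCross_unit, id_whiskerRight, Category.id_comp, Category.comp_id]
        rfl)
      μIso := fun M N => RMod.mkIso (Iso.refl (M.X.X ⊗ N.X.X)) (by
        change diagAct (actCross M) (actCross N) ≫ 𝟙 _ =
          𝟙 (M.X.X ⊗ N.X.X) ▷ (H ⊗ B.X) ≫ actCross (M ⊗ N)
        rw [actCross_tensor, id_whiskerRight, Category.id_comp, Category.comp_id]
        rfl)
      μIso_hom_natural_left := fun f M => by
        ext; exact (Category.comp_id _).trans (Category.id_comp _).symm
      μIso_hom_natural_right := fun M f => by
        ext; exact (Category.comp_id _).trans (Category.id_comp _).symm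
      associativity := fun M N P => by
        ext
        change (𝟙 (M.X.X ⊗ N.X.X)) ▷ P.X.X ≫ 𝟙 _ ≫ (α_ M.X.X N.X.X P.X.X).hom =
          (α_ M.X.X N.X.X P.X.X).hom ≫ M.X.X ◁ 𝟙 (N.X.X ⊗ P.X.X) ≫ 𝟙 _
        simp
      left_unitality := fun M => by
        ext
        change (λ_ M.X.X).hom = 𝟙 (𝟙_ C) ▷ M.X.X ≫ 𝟙 _ ≫ (λ_ M.X.X).hom
        simp
      right_unitality := fun M => by
        ext
        change (ρ_ M.X.X).hom = M.X.X ◁ 𝟙 (𝟙_ C) ≫ 𝟙 _ ≫ (ρ_ M.X.X).hom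
        simp }

/-- The structure morphisms of `RMod.toCross` are identities of `C`: the identification of the two
forgetful functors, a definitional equality, is monoidal. -/
theorem RMod.toCross_comp_forget_isMonoidal (B : RMod H) [HopfObj B] :
    NatTrans.IsMonoidal
      (eqToHom (rfl : RMod.toCross B ⋙ RMod.forget (H ⊗ B.X) = RMod.forget B ⋙ RMod.forget H)) where
  unit := by
    change (𝟙 (𝟙_ C) ≫ 𝟙 (𝟙_ C)) ≫ 𝟙 (𝟙_ C) = 𝟙 (𝟙_ C) ≫ 𝟙 (𝟙_ C)
    simp
  tensor M N := by
    change (𝟙 (M.X.X ⊗ N.X.X) ≫ 𝟙 (M.X.X ⊗ N.X.X)) ≫ 𝟙 (M.X.X ⊗ N.X.X) =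
      (𝟙 M.X.X ⊗ₘ 𝟙 N.X.X) ≫ 𝟙 (M.X.X ⊗ N.X.X) ≫ 𝟙 (M.X.X ⊗ N.X.X)
    simp

theorem RMod.toCross_comp_ofCross (B : RMod H) [HopfObj B] :
    RMod.toCross B ⋙ RMod.ofCross B = 𝟭 (RMod B) :=
  CategoryTheory.Functor.ext (fun M => by
    have h1 : M.X.X ◁ inlCross H η[B].hom ≫ actCross M = M.X.act := by
      have h : M.X.X ◁ η[B].hom ≫ M.act.hom = (ρ_ M.X.X).hom :=
        congrArg RMod.Hom.hom M.isAction.one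
      simp only [inlCross, actCross, crossAct]
      calc
        _ = 𝟙 _ ⊗≫ ((M.X.X ⊗ H) ◁ η[B].hom ≫ M.X.act ▷ B.X) ≫ M.act.hom := by monoidal
        _ = 𝟙 _ ⊗≫ M.X.act ⊗≫ (M.X.X ◁ η[B].hom ≫ M.act.hom) := by
          rw [whisker_exchange]; monoidal
        _ = _ := by rw [h]; monoidal
    have h2 : M.X.X ◁ inrCross H B.X ≫ actCross M = M.act.hom := by
      simp only [inrCross, actCross, crossAct]
      calc
        _ = 𝟙 _ ⊗≫ (M.X.X ◁ η[H] ≫ M.X.act) ▷ B.X ⊗≫ M.act.hom := by monoidal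
        _ = _ := by rw [M.X.isAction.one]; monoidal
    exact RMod.ext_act₂ h1 h2) (fun M N f => by
    refine RMod.hom_ext_eqToHom _ _ (RMod.hom_ext_eqToHom _ _ ?_)
    change f.hom.hom = 𝟙 M.X.X ≫ f.hom.hom ≫ 𝟙 N.X.X
    simp)

theorem RMod.ofCross_comp_toCross (B : RMod H) [HopfObj B] :
    RMod.ofCross B ⋙ RMod.toCross B = 𝟭 (RMod (H ⊗ B.X)) :=
  CategoryTheory.Functor.ext (fun N => RMod.ext_act (crossAct_restrict B N)) (fun M N f => by
    refine RMod.hom_ext_eqToHom _ _ ?_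
    change f.hom = 𝟙 M.X ≫ f.hom ≫ 𝟙 N.X
    simp)

end CrossModules

end BraidedHopf

theorem mainTheorem6 {C : Type u} [Category.{v} C] [MonoidalCategory C] [BraidedCategory C]
    (H : C) [HopfObj H] [IsIso 𝒮[H]] [Quasitriangular H] [SymmetricOnModules H]
    (B : RMod H) [HopfObj B] :
    (∃ _ : HopfObj (YD.ofRMod B),
      μ[YD.ofRMod B].hom = μ[B].hom ∧
      η[YD.ofRMod B].hom = η[B].hom ∧
      Δ[YD.ofRMod B].hom = Δ[B].hom ∧
      ε[YD.ofRMod B].hom = ε[B].hom ∧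
      𝒮[YD.ofRMod B].hom = 𝒮[B].hom) ∧
    ∃ _ : HopfObj (H ⊗ B.X),
      μ[H ⊗ B.X] = crossMul B.act μ[B].hom ∧
      η[H ⊗ B.X] = (λ_ (𝟙_ C)).inv ≫ (η[H] ⊗ₘ η[B].hom) ∧
      Δ[H ⊗ B.X] = crossComul (YD.ofRMod B).coact Δ[B].hom ∧
      ε[H ⊗ B.X] = (ε[H] ⊗ₘ ε[B].hom) ≫ (λ_ (𝟙_ C)).hom ∧
      𝒮[H ⊗ B.X] = crossAntipode B.act (YD.ofRMod B).coact 𝒮[B].hom ∧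
      ∃ (F : RMod B ⥤ RMod (H ⊗ B.X)) (G : RMod (H ⊗ B.X) ⥤ RMod B) (_ : F.Monoidal)
        (e : F ⋙ RMod.forget (H ⊗ B.X) = RMod.forget B ⋙ RMod.forget H),
        F ⋙ G = 𝟭 (RMod B) ∧ G ⋙ F = 𝟭 (RMod (H ⊗ B.X)) ∧
        NatTrans.IsMonoidal (eqToHom e) ∧
        ∀ M : RMod B, (F.obj M).act ≫ (eqToHom e).app M =
          (eqToHom e).app M ▷ (H ⊗ B.X) ≫ (α_ M.X.X H B.X).inv ≫ M.X.act ▷ B.X ≫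
            M.act.hom := by
  refine ⟨⟨YD.hopfObjOfRMod B, rfl, rfl, rfl, rfl, rfl⟩, crossHopfObj B, rfl, rfl, rfl, rfl, rfl,
    ?_⟩
  let _ := crossHopfObj B
  refine ⟨RMod.toCross B, RMod.ofCross B, inferInstance, rfl, RMod.toCross_comp_ofCross B,
    RMod.ofCross_comp_toCross B, RMod.toCross_comp_forget_isMonoidal B, fun M => ?_⟩
  change actCross M ≫ 𝟙 M.X.X = 𝟙 M.X.X ▷ (H ⊗ B.X) ≫ actCross M
  rw [id_whiskerRight, Category.id_comp, Category.comp_id]
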